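/- **Setting.** Let $\mathcal{P}_1,\dots,\mathcal{P}_m$ ($m\ge 1$) be probability distributions on a sample space $\mathcal{Z}$, let $\mathcal{W}$ be a closed convex subset of a finite-dimensional real vector space with a norm $\|\cdot\|_w$ (dual norm $\|\cdot\|_{w,*}$), and let $\nu_w$ be a distance-generating function on $\mathcal{W}$: it is continuous and $1$-strongly convex on $\mathcal{W}$ with respect to $\|\cdot\|_w$, and differentiable relative to $\mathcal{W}$ at every point of $\mathcal{W}$ that minimizes $\mathbf{u}\mapsto\langle \mathbf{p},\mathbf{u}\rangle+\nu_w(\mathbf{u})$ over $\mathcal{W}$ for some linear functional $\mathbf{p}$. Put $B_w(\mathbf{u},\mathbf{v})=\nu_w(\mathbf{u})-[\nu_w(\mathbf{v})+\langle\nabla\nu_w(\mathbf{v}),\mathbf{u}-\mathbf{v}\rangle]$, and let $B_q$ be the Bregman distance generated in the same way on the simplex $\Delta_m=\{\mathbf{q}\in\mathbb{R}^m:\mathbf{q}\ge 0,\ \sum_i q_i=1\}$ by the entropy function $\sum_i q_i\ln q_i$. For a loss $\ell(\mathbf{w};\mathbf{z})$ let $R_i(\mathbf{w})=\mathrm{E}_{\mathbf{z}\sim\mathcal{P}_i}[\ell(\mathbf{w};\mathbf{z})]$,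 $\phi(\mathbf{w},\mathbf{q})=\sum_{i=1}^m q_iR_i(\mathbf{w})$ and $$\epsilon_\phi(\bar{\mathbf{w}},\bar{\mathbf{q}})=\max_{\mathbf{q}\in\Delta_m}\phi(\bar{\mathbf{w}},\mathbf{q})-\min_{\mathbf{w}\in\mathcal{W}}\phi(\mathbf{w},\bar{\mathbf{q}}).$$ **Assumptions.** $\max_{\mathcal{W}}\nu_w-\min_{\mathcal{W}}\nu_w\le D^2$; every risk $R_i$ is convex on $\mathcal{W}$; and, for every $i$ and $\mathcal{P}_i$-almost every $\mathbf{z}$, for all $\mathbf{w}\in\mathcal{W}$: $0\le\ell(\mathbf{w};\mathbf{z})\le1$, $\ell(\cdot;\mathbf{z})$ is differentiable at $\mathbf{w}$ (relative to $\mathcal{W}$), and its gradient satisfies $\|\nabla\ell(\mathbf{w};\mathbf{z})\|_{w,*}\le G$. **Algorithm.** Let $\mathbf{w}_1=\arg\min_{\mathbf{w}\in\mathcal{W}}\nu_w(\mathbf{w})$ and $\mathbf{q}_1=(1/m,\dots,1/m)$. In each round $t=1,\dots,T$ ($T\ge1$) draw one sample $\mathbf{z}_t^{(i)}$ from each $\mathcal{P}_i$,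 all samples being independent, and put $$\mathbf{w}_{t+1}=\arg\min_{\mathbf{w}\in\mathcal{W}}\Big\{\eta_w\Big\langle\sum_{i=1}^m q_{t,i}\nabla\ell(\mathbf{w}_t;\mathbf{z}_t^{(i)}),\mathbf{w}-\mathbf{w}_t\Big\rangle+B_w(\mathbf{w},\mathbf{w}_t)\Big\},$$ $$\mathbf{q}_{t+1}=\arg\min_{\mathbf{q}\in\Delta_m}\Big\{\eta_q\Big\langle-\big(\ell(\mathbf{w}_t;\mathbf{z}_t^{(i)})\big)_{i=1}^m,\mathbf{q}-\mathbf{q}_t\Big\rangle+B_q(\mathbf{q},\mathbf{q}_t)\Big\},$$ with step sizes $\eta_w=D^2\sqrt{\frac{8}{5T(D^2G^2+\ln m)}}$ and $\eta_q=(\ln m)\sqrt{\frac{8}{5T(D^2G^2+\ln m)}}$ (both read as $0$ if $D^2G^2+\ln m=0$). Return $\bar{\mathbf{w}}=\frac1T\sum_{t=1}^T\mathbf{w}_t$ and $\bar{\mathbf{q}}=\frac1T\sum_{t=1}^T\mathbf{q}_t$. **Theorem.** Then $$\mathrm{E}\big[\epsilon_\phi(\bar{\mathbf{w}},\bar{\mathbf{q}})\big]\le2\sqrt{\frac{10(D^2G^2+\ln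 m)}{T}},$$ and for every $\delta\in(0,1)$, with probability at least $1-\delta$, $$\epsilon_\phi(\bar{\mathbf{w}},\bar{\mathbf{q}})\le\Big(8+2\ln\frac2\delta\Big)\sqrt{\frac{10(D^2G^2+\ln m)}{T}}.$$ Consequently there is a constant $C>0$ depending only on $D$ and $G$ such that, for all $m\ge2$, $\epsilon\in(0,1]$ and $\delta\in(0,1)$, a number $T$ of rounds that uses in total $mT\le C\ln^2(2/\delta)\,\frac{m\ln m}{\epsilon^2}$ samples ensures, for every such problem, both $\mathrm{E}[\epsilon_\phi(\bar{\mathbf{w}},\bar{\mathbf{q}})]\le\epsilon$ and $\epsilon_\phi(\bar{\mathbf{w}},\bar{\mathbf{q}})\le\epsilon$ with probability at least $1-\delta$; that is, the sample complexity is $O(m(\log m)/\epsilon^2)$. -/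

import Mathlib

open MeasureTheory ProbabilityTheory

universe uE uZ uO

noncomputable section

namespace GDRO

/-- `x` is a minimizer of `f` over the set `S`. -/
def IsArgmin {F : Type*} (f : F → ℝ) (S : Set F) (x : F) : Prop :=
  x ∈ S ∧ ∀ y ∈ S, f x ≤ f y

section MirrorSetup

variable {F : Type*} [NormedAddCommGroup F] [NormedSpace ℝ F]

/-- The points of `S` that minimize over `S` some linear perturbation of `ν`; these are the points
that mirror descent can visit (for the entropy on the simplex: the points with positive
coordinates). -/
def proxDomain (S : Set F) (ν : F → ℝ) : Set F :=
  {x | ∃ p : F →L[ℝ] ℝ, IsArgmin (fun u => p u + ν u) S x}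

/-- `ν` is a distance-generating function on `S`: continuous on `S`, `1`-strongly convex on `S`
with respect to the norm of `F`, and differentiable (relative to `S`) at every point that mirror
descent can visit. -/
structure IsDistanceGenerating (S : Set F) (ν : F → ℝ) : Prop where
  continuousOn : ContinuousOn ν S
  strongConvexOn : StrongConvexOn S 1 ν
  differentiableWithinAt : ∀ x ∈ proxDomain S ν, DifferentiableWithinAt ℝ ν S x

/-- The Bregman distance `B(u, v) = ν(u) - [ν(v) + ⟨∇ν(v), u - v⟩]`. The derivative is taken
relative to the convex set `S`; on the directions `u - v` with `u, v ∈ S` it is uniquely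
determined, even when `S` has empty interior. -/
def bregman (S : Set F) (ν : F → ℝ) (u v : F) : ℝ :=
  ν u - (ν v + fderivWithin ℝ ν S v (u - v))

end MirrorSetup

/-- The entropy function `∑ i, q i * log (q i)` (with `0 * log 0 = 0`). -/
def entropy {m : ℕ} (q : Fin m → ℝ) : ℝ := ∑ i, q i * Real.log (q i)

/-- The data of a group distributionally robust optimization problem: the domain `W`, the function
`ν` that generates the distance on it, the loss `ℓ(w; z)` with its gradient in `w`, and the `m`
distributions on the sample space `Z`. -/
structure Problem (E Z : Type*) [NormedAddCommGroup E] [NormedSpace ℝ E] [MeasurableSpace Z]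
    (m : ℕ) where
  W : Set E
  ν : E → ℝ
  loss : E → Z → ℝ
  grad : E → Z → (E →L[ℝ] ℝ)
  P : Fin m → Measure Z

namespace Problem

variable {E Z : Type*} [NormedAddCommGroup E] [NormedSpace ℝ E] [MeasurableSpace Z] {m : ℕ}

/-- The risk `R_i(w) = E_{z ∼ P_i}[ℓ(w; z)]`. -/
def risk (p : Problem E Z m) (i : Fin m) (w : E) : ℝ := ∫ z, p.loss w z ∂(p.P i)

/-- The saddle function `φ(w, q) = ∑ i, q i * R_i(w)`. -/
def phi (p : Problem E Z m) (w : E) (q : Fin m → ℝ) : ℝ := ∑ i, q i * p.risk i w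

/-- The error `ε_φ(w, q) = max_{q' ∈ Δ_m} φ(w, q') - min_{w' ∈ W} φ(w', q)`. -/
def err (p : Problem E Z m) (w : E) (q : Fin m → ℝ) : ℝ :=
  sSup ((fun q' => p.phi w q') '' stdSimplex ℝ (Fin m)) - sInf ((fun w' => p.phi w' q) '' p.W)

/-- The standing assumptions. The norm of `E` is the norm `‖·‖_w`, and the norm of `E →L[ℝ] ℝ` is
its dual norm. -/
structure Assumptions [MeasurableSpace E] (p : Problem E Z m) (D G : ℝ) : Prop where
  isProbabilityMeasure : ∀ i, IsProbabilityMeasure (p.P i)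
  measurable_loss : Measurable fun x : E × Z => p.loss x.1 x.2
  measurable_grad : Measurable fun x : E × Z => p.grad x.1 x.2
  distanceGenerating : IsDistanceGenerating p.W p.ν
  isClosed : IsClosed p.W
  convex : Convex ℝ p.W
  diameter : ∀ u ∈ p.W, ∀ v ∈ p.W, p.ν u - p.ν v ≤ D ^ 2
  convexOn_risk : ∀ i, ConvexOn ℝ p.W (p.risk i)
  loss_mem : ∀ i, ∀ᵐ z ∂(p.P i), ∀ w ∈ p.W, 0 ≤ p.loss w z ∧ p.loss w z ≤ 1
  hasGradient : ∀ i, ∀ᵐ z ∂(p.P i), ∀ w ∈ p.W,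
    HasFDerivWithinAt (fun u => p.loss u z) (p.grad w z) p.W w
  norm_grad_le : ∀ i, ∀ᵐ z ∂(p.P i), ∀ w ∈ p.W, ‖p.grad w z‖ ≤ G

/-- The stochastic gradient in `w` at `(w, q)` computed from the samples `z i`. -/
def stochGradW (p : Problem E Z m) (w : E) (q : Fin m → ℝ) (z : Fin m → Z) : E →L[ℝ] ℝ :=
  ∑ i, q i • p.grad w (z i)

/-- The stochastic gradient in `q` at `w` computed from the samples `z i`. -/
def stochGradQ (p : Problem E Z m) (w : E) (z : Fin m → Z) : Fin m → ℝ :=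
  fun i => p.loss w (z i)

/-- `w` and `q` are iterates of stochastic mirror descent for the problem `p` with step sizes `ηw`
and `ηq`, over `T` rounds, where `z t i` is the sample from the `i`-th distribution that is used in
round `t`. Rounds are numbered `0, …, T - 1`. -/
structure IsRun (p : Problem E Z m) (ηw ηq : ℝ) (T : ℕ) (z : ℕ → Fin m → Z)
    (w : ℕ → E) (q : ℕ → Fin m → ℝ) : Prop where
  init_w : IsArgmin p.ν p.W (w 0)
  init_q : ∀ i, q 0 i = 1 / (m : ℝ)
  step_w : ∀ t < T, IsArgmin
    (fun u => ηw * p.stochGradW (w t) (q t) (z t) (u - w t) + bregman p.W p.ν u (w t))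
    p.W (w (t + 1))
  step_q : ∀ t < T, IsArgmin
    (fun r => ηq * ∑ i, (-p.stochGradQ (w t) (z t) i) * (r i - q t i)
      + bregman (stdSimplex ℝ (Fin m)) entropy r (q t))
    (stdSimplex ℝ (Fin m)) (q (t + 1))

/-- In each of the rounds `t < T` one sample is drawn from each of the `m` distributions, all
`m * T` samples being independent. -/
structure IsSampling {Ω : Type*} [MeasurableSpace Ω] (p : Problem E Z m) (μ : Measure Ω) (T : ℕ)
    (z : ℕ → Fin m → Ω → Z) : Prop where
  measurable : ∀ t < T, ∀ i, Measurable (z t i)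
  law : ∀ t < T, ∀ i, μ.map (z t i) = p.P i
  indep : iIndepFun (fun k : Fin T × Fin m => z k.1 k.2) μ

end Problem

/-- The average of the first `T` terms of a sequence. -/
def average {F : Type*} [AddCommGroup F] [Module ℝ F] (T : ℕ) (x : ℕ → F) : F :=
  (1 / (T : ℝ)) • ∑ t ∈ Finset.range T, x t

/-- The step size for `w`. -/
def stepW (D G : ℝ) (m T : ℕ) : ℝ :=
  D ^ 2 * √(8 / (5 * T * (D ^ 2 * G ^ 2 + Real.log m)))

/-- The step size for `q`. -/
def stepQ (D G : ℝ) (m T : ℕ) : ℝ :=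
  Real.log m * √(8 / (5 * T * (D ^ 2 * G ^ 2 + Real.log m)))

/-- A randomized execution of stochastic mirror descent, over `T` rounds and with the step sizes
`stepW` and `stepQ`, on a problem with `m` distributions that satisfies the standing assumptions
with the constants `D` and `G`. -/
structure Execution (E Z Ω : Type*) [NormedAddCommGroup E] [NormedSpace ℝ E] [MeasurableSpace E]
    [MeasurableSpace Z] [MeasurableSpace Ω] (D G : ℝ) (m T : ℕ) where
  p : Problem E Z m
  assumptions : p.Assumptions D G
  μ : Measure Ω
  isProbabilityMeasure : IsProbabilityMeasure μ
  z : ℕ → Fin m → Ω → Z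
  sampling : p.IsSampling μ T z
  w : ℕ → Ω → E
  q : ℕ → Ω → Fin m → ℝ
  run : ∀ ω, p.IsRun (stepW D G m T) (stepQ D G m T) T (fun t i => z t i ω)
    (fun t => w t ω) (fun t => q t ω)

/-- The error `ε_φ` of the averaged iterates, as a random variable. -/
def Execution.error {E Z Ω : Type*} [NormedAddCommGroup E] [NormedSpace ℝ E] [MeasurableSpace E]
    [MeasurableSpace Z] [MeasurableSpace Ω] {D G : ℝ} {m T : ℕ}
    (x : Execution E Z Ω D G m T) (ω : Ω) : ℝ :=
  x.p.err (average T fun t => x.w t ω) (average T fun t => x.q t ω)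

end GDRO

end

noncomputable section

namespace GDRO

open Filter Topology

/-! ### Convex analysis and the deterministic regret of mirror descent. -/

section Convexity

variable {F : Type*} [NormedAddCommGroup F] [NormedSpace ℝ F]

/-! Write L = D²G² + ln m. For fixed r in the simplex and u in W, convexity of the risks and
linearity in q bound φ(w̄, r) - φ(ū, q̄), taken with ū = u, by the average of the gaps φ(w_t, r) -
φ(u, q_t). The gradient inequality `Problem.Assumptions.risk_sub_le` linearizes each gap. Replacing
true gradients by sampled ones leaves two mirror descent regrets and an inner product of the noise
with (w_t - u, r - q_t).

The comparators u and r are chosen after all samples are seen, so this last term is not a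
martingale. The remedy is a second pair of mirror descent iterates (v_t, s_t), driven by the noise
itself (`ghostW`, `ghostQ`). The parts v_t - u and r - s_t again give regrets, bounded uniformly in
u and r. The parts w_t - v_t and s_t - q_t depend only on earlier samples and give a martingale
difference, `Problem.noise`.

The four regrets have gradients bounded by G, 1, 2G, 2. With steps D²c and c ln m they add up to at
most 4/c + (5/2)cTL. The chosen c balances the two terms, whence `IsRun.err_le`: almost surely the
error is at most 2√(10L/T) plus the averaged noise. The noise has mean zero, which gives the
expectation bound. Its increments are at most 2√(10L) in absolute value, so iterating Hoeffding's
lemma and applying Chernoff's bound gives the tail.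

Two further points carry weight. The entropic step is solved explicitly as multiplicative weights,
so strong convexity of the entropy is not needed. The iterates are specified only as minimizers;
strong convexity makes these unique, hence measurable functions of the past samples
(`measurable_state`), as the martingale argument requires. -/

theorem convex_step_mem {S : Set F} (hS : Convex ℝ S) {x u : F} (hx : x ∈ S) (hu : u ∈ S) (n : ℕ) :
    x + (1 / ((n : ℝ) + 1)) • (u - x) ∈ S := by
  refine hS.add_smul_sub_mem hx hu ⟨by positivity, ?_⟩
  rw [div_le_one (by positivity)]
  linarith [(Nat.cast_nonneg n : (0 : ℝ) ≤ n)]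

/-- A derivative relative to a convex set is a limit of difference quotients along segments. -/
theorem tendsto_segment_quotient {S : Set F} (hS : Convex ℝ S) {f : F → ℝ} {f' : F →L[ℝ] ℝ}
    {x u : F} (hf : HasFDerivWithinAt f f' S x) (hx : x ∈ S) (hu : u ∈ S) :
    Tendsto (fun n : ℕ => ((n : ℝ) + 1) * (f (x + (1 / ((n : ℝ) + 1)) • (u - x)) - f x)) atTop
      (𝓝 (f' (u - x))) := by
  refine hf.lim (c := fun n : ℕ => (n : ℝ) + 1)
    (d := fun n : ℕ => (1 / ((n : ℝ) + 1)) • (u - x)) (v := u - x) ?_ ?_ ?_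
  · simpa using (tendsto_one_div_add_atTop_nhds_zero_nat (𝕜 := ℝ)).smul_const (u - x)
  · exact Eventually.of_forall fun n => convex_step_mem hS hx hu n
  · refine tendsto_const_nhds.congr fun n => ?_
    have : (n : ℝ) + 1 ≠ 0 := by positivity
    rw [smul_smul, mul_one_div_cancel this, one_smul]

/-- On directions pointing into a convex set the relative derivative is unique. -/
theorem fderivWithin_sub_eq {S : Set F} (hS : Convex ℝ S) {f : F → ℝ} {f' : F →L[ℝ] ℝ}
    {x u : F} (hf : HasFDerivWithinAt f f' S x) (hx : x ∈ S) (hu : u ∈ S) :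
    fderivWithin ℝ f S x (u - x) = f' (u - x) :=
  tendsto_nhds_unique
    (tendsto_segment_quotient hS hf.differentiableWithinAt.hasFDerivWithinAt hx hu)
    (tendsto_segment_quotient hS hf hx hu)

/-- First-order optimality at a minimizer over a convex set. -/
theorem IsArgmin.fderiv_nonneg {S : Set F} (hS : Convex ℝ S) {f : F → ℝ} {f' : F →L[ℝ] ℝ}
    {x u : F} (hx : IsArgmin f S x) (hf : HasFDerivWithinAt f f' S x) (hu : u ∈ S) :
    0 ≤ f' (u - x) := by
  refine ge_of_tendsto' (tendsto_segment_quotient hS hf hx.1 hu) fun n => ?_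
  have := hx.2 _ (convex_step_mem hS hx.1 hu n)
  have hn : (0 : ℝ) ≤ (n : ℝ) + 1 := by positivity
  exact mul_nonneg hn (by linarith)

theorem strongConvexOn_segment {S : Set F} {f : F → ℝ} (hf : StrongConvexOn S 1 f) {x u : F}
    (hx : x ∈ S) (hu : u ∈ S) {s : ℝ} (hs : 0 ≤ s) (hs' : s ≤ 1) :
    f (x + s • (u - x)) ≤ (1 - s) * f x + s * f u - (1 - s) * s * (1 / 2 * ‖u - x‖ ^ 2) := by
  have h := hf.2 hx hu (sub_nonneg.2 hs') hs (by ring)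
  have e : (1 - s) • x + s • u = x + s • (u - x) := by
    simp only [sub_smul, smul_sub, one_smul]; abel
  rw [e, norm_sub_rev] at h
  simpa using h

/-- Strong convexity on the segment from x to u, divided by the step length 1/(n+1), passes to the
limit. -/
theorem half_sq_le_bregman {S : Set F} {ν : F → ℝ} (hν : StrongConvexOn S 1 ν) {x u : F}
    (hd : DifferentiableWithinAt ℝ ν S x) (hx : x ∈ S) (hu : u ∈ S) :
    1 / 2 * ‖u - x‖ ^ 2 ≤ bregman S ν u x := by
  have h1 := tendsto_segment_quotient hν.1 hd.hasFDerivWithinAt hx hu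
  have h2 : Tendsto (fun n : ℕ => ν u - ν x - (1 - 1 / ((n : ℝ) + 1)) * (1 / 2 * ‖u - x‖ ^ 2))
      atTop (𝓝 (ν u - ν x - (1 - 0) * (1 / 2 * ‖u - x‖ ^ 2))) :=
    ((tendsto_one_div_add_atTop_nhds_zero_nat.const_sub 1).mul_const _).const_sub _
  have h3 := le_of_tendsto_of_tendsto' h1 h2 fun n => by
    have hn : (0 : ℝ) < (n : ℝ) + 1 := by positivity
    have h := strongConvexOn_segment hν hx hu (s := 1 / ((n : ℝ) + 1)) (by positivity)
      (by rw [div_le_one hn]; linarith [(Nat.cast_nonneg n : (0 : ℝ) ≤ n)])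
    have h' := mul_le_mul_of_nonneg_left h hn.le
    set s := 1 / ((n : ℝ) + 1) with hs
    have e : ((n : ℝ) + 1) * s = 1 := by rw [hs]; field_simp
    calc _ = ((n : ℝ) + 1) * ν (x + s • (u - x)) - ((n : ℝ) + 1) * ν x := by ring
      _ ≤ ((n : ℝ) + 1) * ((1 - s) * ν x + s * ν u - (1 - s) * s * (1 / 2 * ‖u - x‖ ^ 2))
          - ((n : ℝ) + 1) * ν x := by linarith
      _ = (((n : ℝ) + 1) * s) * (ν u - ν x - (1 - s) * (1 / 2 * ‖u - x‖ ^ 2)) := by ring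
      _ = _ := by rw [e]; ring
  unfold bregman
  linarith

/-- Minimality takes the place of the first-order term, so no derivative at x is involved: compare x
with a point of the segment, cancel the step length and let it tend to 0. -/
theorem half_sq_le_of_isArgmin {S : Set F} {ν : F → ℝ} (hν : StrongConvexOn S 1 ν) {x u : F}
    (hx : IsArgmin ν S x) (hu : u ∈ S) : 1 / 2 * ‖u - x‖ ^ 2 ≤ ν u - ν x := by
  have h2 : Tendsto (fun n : ℕ => (1 - 1 / ((n : ℝ) + 1)) * (1 / 2 * ‖u - x‖ ^ 2))
      atTop (𝓝 ((1 - 0) * (1 / 2 * ‖u - x‖ ^ 2))) :=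
    ((tendsto_one_div_add_atTop_nhds_zero_nat.const_sub 1).mul_const _)
  have h3 := le_of_tendsto' h2 (b := ν u - ν x) fun n => by
    have hn : (0 : ℝ) < (n : ℝ) + 1 := by positivity
    have h := strongConvexOn_segment hν hx.1 hu (s := 1 / ((n : ℝ) + 1)) (by positivity)
      (by rw [div_le_one hn]; linarith [(Nat.cast_nonneg n : (0 : ℝ) ≤ n)])
    have h0 := hx.2 _ (convex_step_mem hν.1 hx.1 hu n)
    set s := 1 / ((n : ℝ) + 1) with hs
    have hs0 : 0 < s := by positivity
    refine le_of_mul_le_mul_left ?_ hs0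
    linarith
  linarith

/-- The objective of a mirror descent step from `w` with the linear functional `g`. -/
def mirrorObjective (S : Set F) (ν : F → ℝ) (w : F) (g : F →L[ℝ] ℝ) (u : F) : ℝ :=
  g (u - w) + bregman S ν u w

/-- This form, linear plus ν plus a constant, shows that every mirror step stays in `proxDomain`,
where ν is differentiable, and gives continuity and uniqueness. -/
theorem mirrorObjective_eq (S : Set F) (ν : F → ℝ) (w : F) (g : F →L[ℝ] ℝ) (u : F) :
    mirrorObjective S ν w g u =
      (g - fderivWithin ℝ ν S w) u + ν u + (fderivWithin ℝ ν S w w - g w - ν w) := by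
  simp only [mirrorObjective, bregman, map_sub, sub_apply]
  ring

theorem mem_proxDomain_of_isArgmin {S : Set F} {ν : F → ℝ} {x : F} (hx : IsArgmin ν S x) :
    x ∈ proxDomain S ν := ⟨0, by simpa [IsArgmin] using hx⟩

theorem mem_proxDomain_of_mirrorObjective {S : Set F} {ν : F → ℝ} {w x : F} {g : F →L[ℝ] ℝ}
    (hx : IsArgmin (mirrorObjective S ν w g) S x) : x ∈ proxDomain S ν := by
  refine ⟨g - fderivWithin ℝ ν S w, hx.1, fun y hy => ?_⟩
  have := hx.2 y hy
  rw [mirrorObjective_eq, mirrorObjective_eq] at this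
  linarith

/-- The midpoint of two minimizers would have a strictly smaller value unless they coincide. -/
theorem isArgmin_unique_of_linear_add {S : Set F} {ν : F → ℝ} (hν : StrongConvexOn S 1 ν)
    {f : F → ℝ} {p : F →L[ℝ] ℝ} {k : ℝ} (hf : ∀ u, f u = p u + ν u + k) {x y : F}
    (hx : IsArgmin f S x) (hy : IsArgmin f S y) : x = y := by
  have h := strongConvexOn_segment hν hx.1 hy.1 (s := 1 / 2) (by norm_num) (by norm_num)
  have hm : x + (1 / 2 : ℝ) • (y - x) ∈ S :=
    hν.1.add_smul_sub_mem hx.1 hy.1 ⟨by norm_num, by norm_num⟩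
  have h1 := hx.2 _ hm
  have h2 := hy.2 _ hm
  simp only [hf, map_add, map_smul, map_sub, smul_eq_mul] at h1 h2
  have h3 : ‖y - x‖ ^ 2 ≤ 0 := by nlinarith
  have h4 : ‖y - x‖ = 0 := by
    have := norm_nonneg (y - x); nlinarith
  exact (sub_eq_zero.1 (norm_eq_zero.1 h4)).symm

theorem mirrorObjective_isArgmin_unique {S : Set F} {ν : F → ℝ} (hν : StrongConvexOn S 1 ν)
    {w x y : F} {g : F →L[ℝ] ℝ} (hx : IsArgmin (mirrorObjective S ν w g) S x)
    (hy : IsArgmin (mirrorObjective S ν w g) S y) : x = y :=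
  isArgmin_unique_of_linear_add hν (mirrorObjective_eq S ν w g) hx hy

theorem IsDistanceGenerating.continuousOn_mirrorObjective {S : Set F} {ν : F → ℝ}
    (hν : IsDistanceGenerating S ν) (w : F) (g : F →L[ℝ] ℝ) :
    ContinuousOn (mirrorObjective S ν w g) S := by
  rw [funext (mirrorObjective_eq S ν w g)]
  exact (((g - fderivWithin ℝ ν S w).continuous.continuousOn).add hν.continuousOn).add
    continuousOn_const

/-- The one-step inequality of mirror descent. -/
theorem mirror_step_le {S : Set F} {ν : F → ℝ} (hν : IsDistanceGenerating S ν) {w x : F}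
    {g : F →L[ℝ] ℝ} (hw : w ∈ proxDomain S ν) (hx : IsArgmin (mirrorObjective S ν w g) S x)
    {u : F} (hu : u ∈ S) :
    g (w - u) ≤ bregman S ν u w - bregman S ν u x + 1 / 2 * ‖g‖ ^ 2 := by
  have hwS : w ∈ S := hw.choose_spec.1
  have hS := hν.strongConvexOn.1
  have hx' := mem_proxDomain_of_mirrorObjective hx
  have hdw := hν.differentiableWithinAt w hw
  have hdx := hν.differentiableWithinAt x hx'
  have hder : HasFDerivWithinAt (mirrorObjective S ν w g)
      ((g - fderivWithin ℝ ν S w) + fderivWithin ℝ ν S x) S x := by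
    rw [funext (mirrorObjective_eq S ν w g)]
    exact (((g - fderivWithin ℝ ν S w).hasFDerivWithinAt).add hdx.hasFDerivWithinAt).add_const _
  -- Optimality at x is the three-point inequality. The remaining term `g (w - x)` is split by
  -- Young's inequality, and its quadratic part is paid for by the strong convexity bound on B(x,
  -- w).
  have h1 := hx.fderiv_nonneg hS hder hu
  have h2 := half_sq_le_bregman hν.strongConvexOn hdw hwS hx.1
  have h3 : g (w - x) ≤ ‖g‖ * ‖x - w‖ := by
    rw [norm_sub_rev]
    exact (le_abs_self _).trans (g.le_opNorm _)
  have h4 : ‖g‖ * ‖x - w‖ ≤ 1 / 2 * ‖g‖ ^ 2 + 1 / 2 * ‖x - w‖ ^ 2 := by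
    nlinarith [sq_nonneg (‖g‖ - ‖x - w‖)]
  simp only [bregman, map_sub, sub_apply, add_apply] at *
  linarith

theorem bregman_nonneg {S : Set F} {ν : F → ℝ} (hν : IsDistanceGenerating S ν) {x u : F}
    (hx : x ∈ proxDomain S ν) (hu : u ∈ S) : 0 ≤ bregman S ν u x :=
  le_trans (by positivity) (half_sq_le_bregman hν.strongConvexOn
    (hν.differentiableWithinAt x hx) hx.choose_spec.1 hu)

/-- The regret bound of mirror descent. -/
theorem mirror_regret {S : Set F} {ν : F → ℝ} (hν : IsDistanceGenerating S ν) {A K : ℝ}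
    (hA : ∀ u ∈ S, ∀ v ∈ S, ν u - ν v ≤ A) {w : ℕ → F} {g : ℕ → F →L[ℝ] ℝ} {T : ℕ}
    (h0 : IsArgmin ν S (w 0))
    (hstep : ∀ t < T, IsArgmin (mirrorObjective S ν (w t) (g t)) S (w (t + 1)))
    (hg : ∀ t < T, ‖g t‖ ≤ K) {u : F} (hu : u ∈ S) :
    ∑ t ∈ Finset.range T, g t (w t - u) ≤ A + T * (1 / 2 * K ^ 2) := by
  have hprox : ∀ t ≤ T, w t ∈ proxDomain S ν := by
    intro t ht
    cases t with
    | zero => exact mem_proxDomain_of_isArgmin h0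
    | succ t => exact mem_proxDomain_of_mirrorObjective (hstep t ht)
  have hsum : ∑ t ∈ Finset.range T, g t (w t - u) ≤ ∑ t ∈ Finset.range T,
      ((bregman S ν u (w t) - bregman S ν u (w (t + 1))) + 1 / 2 * K ^ 2) := by
    refine Finset.sum_le_sum fun t ht => ?_
    have ht' := Finset.mem_range.1 ht
    have h := mirror_step_le hν (hprox t ht'.le) (hstep t ht') hu
    have : ‖g t‖ ^ 2 ≤ K ^ 2 := pow_le_pow_left₀ (norm_nonneg _) (hg t ht') 2
    linarith
  rw [Finset.sum_add_distrib, Finset.sum_range_sub'] at hsum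
  simp only [Finset.sum_const, Finset.card_range, nsmul_eq_mul] at hsum
  have hb := bregman_nonneg hν (hprox T le_rfl) hu
  -- Since w 0 minimizes ν, the linear term of B(u, w 0) only helps, so B(u, w 0) is at most the
  -- range of ν.
  have hd := h0.fderiv_nonneg hν.strongConvexOn.1
    (hν.differentiableWithinAt _ (hprox 0 T.zero_le)).hasFDerivWithinAt hu
  have hA' := hA u hu _ h0.1
  have : bregman S ν u (w 0) ≤ A := by unfold bregman; linarith
  linarith

/-- A set whose distance-generating function has range at most `D ^ 2` lies within `√2 * D` of the
minimizer. -/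
theorem norm_sub_argmin_le {S : Set F} {ν : F → ℝ} (hν : StrongConvexOn S 1 ν) {D : ℝ}
    (hD : ∀ u ∈ S, ∀ v ∈ S, ν u - ν v ≤ D ^ 2) {x u : F} (hx : IsArgmin ν S x) (hu : u ∈ S) :
    ‖u - x‖ ≤ √2 * |D| := by
  have h1 := half_sq_le_of_isArgmin hν hx hu
  have h2 := hD u hu x hx.1
  refine abs_le_of_sq_le_sq' ?_ (by positivity) |>.2
  rw [mul_pow, Real.sq_sqrt (by norm_num), sq_abs]
  linarith

theorem norm_sub_le_of_argmin {S : Set F} {ν : F → ℝ} (hν : StrongConvexOn S 1 ν) {D : ℝ}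
    (hD : ∀ u ∈ S, ∀ v ∈ S, ν u - ν v ≤ D ^ 2) {x u v : F} (hx : IsArgmin ν S x) (hu : u ∈ S)
    (hv : v ∈ S) : ‖u - v‖ ≤ 2 * √2 * |D| := by
  have h := norm_sub_le_norm_sub_add_norm_sub u x v
  rw [norm_sub_rev x v] at h
  linarith [norm_sub_argmin_le hν hD hx hu, norm_sub_argmin_le hν hD hx hv]

/-- Compactness supplies the existence of the comparison steps and the measurable selection of
minimizers. -/
theorem isCompact_of_argmin [FiniteDimensional ℝ F] {S : Set F} (hS : IsClosed S) {ν : F → ℝ}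
    (hν : StrongConvexOn S 1 ν) {D : ℝ} (hD : ∀ u ∈ S, ∀ v ∈ S, ν u - ν v ≤ D ^ 2) {x : F}
    (hx : IsArgmin ν S x) : IsCompact S := by
  have := FiniteDimensional.proper ℝ F
  refine Metric.isCompact_of_isClosed_isBounded hS ?_
  refine (Metric.isBounded_closedBall (x := x) (r := √2 * |D|)).subset fun u hu => ?_
  rw [mem_closedBall_iff_norm]
  exact norm_sub_argmin_le hν hD hx hu

end Convexity

/-! ### Entropy and multiplicative weights. -/

section Hedge

variable {m : ℕ}

/-- The multiplicative-weights update. -/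
def hedgeStep (q l : Fin m → ℝ) : Fin m → ℝ :=
  fun i => q i * Real.exp (l i) / ∑ j, q j * Real.exp (l j)

/-- The open simplex. -/
def posSimplex (m : ℕ) : Set (Fin m → ℝ) := {q | (∀ i, 0 < q i) ∧ ∑ i, q i = 1}

theorem posSimplex_subset : posSimplex m ⊆ stdSimplex ℝ (Fin m) :=
  fun _ hq => ⟨fun i => (hq.1 i).le, hq.2⟩

theorem partition_pos {q : Fin m → ℝ} (hq : q ∈ posSimplex m) (l : Fin m → ℝ) :
    0 < ∑ j, q j * Real.exp (l j) := by
  refine Finset.sum_pos (fun i _ => mul_pos (hq.1 i) (Real.exp_pos _)) ?_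
  by_contra h
  rw [Finset.not_nonempty_iff_eq_empty] at h
  have := hq.2
  simp [h] at this

theorem hedgeStep_mem {q : Fin m → ℝ} (hq : q ∈ posSimplex m) (l : Fin m → ℝ) :
    hedgeStep q l ∈ posSimplex m := by
  have hZ := partition_pos hq l
  refine ⟨fun i => div_pos (mul_pos (hq.1 i) (Real.exp_pos _)) hZ, ?_⟩
  simp only [hedgeStep]
  rw [← Finset.sum_div, div_self hZ.ne']

theorem log_hedgeStep {q : Fin m → ℝ} (hq : q ∈ posSimplex m) (l : Fin m → ℝ) (i : Fin m) :
    Real.log (hedgeStep q l i) =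
      Real.log (q i) + l i - Real.log (∑ j, q j * Real.exp (l j)) := by
  rw [hedgeStep, Real.log_div (mul_pos (hq.1 i) (Real.exp_pos _)).ne' (partition_pos hq l).ne',
    Real.log_mul (hq.1 i).ne' (Real.exp_ne_zero _), Real.log_exp]

theorem hasFDerivAt_entropy {q : Fin m → ℝ} (hq : ∀ i, 0 < q i) :
    HasFDerivAt (entropy (m := m))
      (∑ i, (Real.log (q i) + 1) • ContinuousLinearMap.proj (R := ℝ) (φ := fun _ : Fin m => ℝ) i)
      q := by
  unfold entropy
  refine HasFDerivAt.fun_sum fun i _ => ?_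
  exact (Real.hasDerivAt_mul_log (hq i).ne').comp_hasFDerivAt q
    (ContinuousLinearMap.proj (R := ℝ) (φ := fun _ : Fin m => ℝ) i).hasFDerivAt

/-- The constant 1 in the derivative log q + 1 drops out because r and q have equal sums, leaving
the relative entropy. -/
theorem bregman_entropy {q r : Fin m → ℝ} (hq : q ∈ posSimplex m)
    (hr : r ∈ stdSimplex ℝ (Fin m)) :
    bregman (stdSimplex ℝ (Fin m)) entropy r q =
      ∑ i, (r i * Real.log (r i) - r i * Real.log (q i)) := by
  rw [bregman, fderivWithin_sub_eq (convex_stdSimplex ℝ (Fin m))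
    (hasFDerivAt_entropy hq.1).hasFDerivWithinAt (posSimplex_subset hq) hr]
  simp only [sum_apply, smul_apply,
    ContinuousLinearMap.proj_apply, Pi.sub_apply, smul_eq_mul, entropy]
  have h : ∑ i, (r i - q i) = 0 := by rw [Finset.sum_sub_distrib, hr.2, hq.2, sub_self]
  have e : ∑ i, (Real.log (q i) + 1) * (r i - q i) =
      ∑ i, Real.log (q i) * (r i - q i) + ∑ i, (r i - q i) := by
    rw [← Finset.sum_add_distrib]; exact Finset.sum_congr rfl fun i _ => by ring
  rw [e, h, add_zero, ← Finset.sum_add_distrib, ← Finset.sum_sub_distrib]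
  exact Finset.sum_congr rfl fun i _ => by ring

/-- Gibbs' inequality with its equality case. -/
theorem eq_of_relative_entropy_nonpos {q r : Fin m → ℝ} (hq : q ∈ posSimplex m)
    (hr : r ∈ stdSimplex ℝ (Fin m))
    (h : ∑ i, (r i * Real.log (r i) - r i * Real.log (q i)) ≤ 0) : r = q := by
  -- Each summand of the relative entropy becomes nonnegative after adding q i - r i, and these
  -- corrections sum to zero.
  have hk : ∀ i, q i * InformationTheory.klFun (r i / q i) =
      (r i * Real.log (r i) - r i * Real.log (q i)) + (q i - r i) := by
    intro i
    have hqi := (hq.1 i).ne'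
    rcases eq_or_ne (r i) 0 with h0 | h0
    · simp [h0, InformationTheory.klFun]
    · rw [InformationTheory.klFun, Real.log_div h0 hqi]
      field_simp
      ring
  have hnn : ∀ i ∈ Finset.univ, 0 ≤ q i * InformationTheory.klFun (r i / q i) := fun i _ =>
    mul_nonneg (hq.1 i).le (InformationTheory.klFun_nonneg (div_nonneg (hr.1 i) (hq.1 i).le))
  have hs : ∑ i, q i * InformationTheory.klFun (r i / q i) = 0 := by
    refine le_antisymm ?_ (Finset.sum_nonneg hnn)
    simp only [hk]
    rw [Finset.sum_add_distrib, Finset.sum_sub_distrib (f := q), hr.2, hq.2]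
    linarith
  funext i
  have h0 := (Finset.sum_eq_zero_iff_of_nonneg hnn).1 hs i (Finset.mem_univ i)
  have h1 := (mul_eq_zero.1 h0).resolve_left (hq.1 i).ne'
  rw [InformationTheory.klFun_eq_zero_iff (div_nonneg (hr.1 i) (hq.1 i).le),
    div_eq_one_iff_eq (hq.1 i).ne'] at h1
  exact h1

/-- The entropic mirror step is the multiplicative-weights update. -/
theorem eq_hedgeStep_of_isArgmin {q r l : Fin m → ℝ} {η : ℝ} (hq : q ∈ posSimplex m)
    (hr : IsArgmin (fun r => η * ∑ i, (-l i) * (r i - q i)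
      + bregman (stdSimplex ℝ (Fin m)) entropy r q) (stdSimplex ℝ (Fin m)) r) :
    r = hedgeStep q (fun i => η * l i) := by
  set p := hedgeStep q (fun i => η * l i) with hp
  have hpm : p ∈ posSimplex m := hedgeStep_mem hq _
  -- Up to a constant independent of s, the objective is the relative entropy of s with respect to
  -- p, so Gibbs' inequality identifies the minimizer.
  have key : ∀ s ∈ stdSimplex ℝ (Fin m), η * ∑ i, (-l i) * (s i - q i)
      + bregman (stdSimplex ℝ (Fin m)) entropy s q =
      ∑ i, (s i * Real.log (s i) - s i * Real.log (p i)) +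
        (η * ∑ i, l i * q i - Real.log (∑ j, q j * Real.exp (η * l j))) := by
    intro s hs
    rw [bregman_entropy hq hs]
    have e : ∑ i, (s i * Real.log (s i) - s i * Real.log (p i)) =
        ∑ i, ((s i * Real.log (s i) - s i * Real.log (q i)) - η * (l i * s i)) +
          (∑ i, s i) * Real.log (∑ j, q j * Real.exp (η * l j)) := by
      rw [Finset.sum_mul, ← Finset.sum_add_distrib]
      refine Finset.sum_congr rfl fun i _ => ?_
      rw [hp, log_hedgeStep hq]; ring
    have e1 : ∑ i, ((s i * Real.log (s i) - s i * Real.log (q i)) - η * (l i * s i)) =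
        ∑ i, (s i * Real.log (s i) - s i * Real.log (q i)) - η * ∑ i, l i * s i := by
      rw [Finset.mul_sum, ← Finset.sum_sub_distrib]
    rw [e, hs.2, e1]
    have e2 : ∑ i, (-l i) * (s i - q i) = ∑ i, l i * q i - ∑ i, l i * s i := by
      rw [← Finset.sum_sub_distrib]; exact Finset.sum_congr rfl fun i _ => by ring
    rw [e2]; ring
  have h := hr.2 p (posSimplex_subset hpm)
  simp only at h
  rw [key r hr.1, key p (posSimplex_subset hpm)] at h
  refine eq_of_relative_entropy_nonpos hpm hr.1 ?_
  simp only [sub_self, Finset.sum_const_zero] at h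
  linarith

theorem abs_sub_average_le {q l : Fin m → ℝ} (hq : q ∈ posSimplex m) {a K : ℝ}
    (hl : ∀ i, a ≤ l i ∧ l i ≤ a + K) (i : Fin m) : |l i - ∑ j, q j * l j| ≤ K := by
  have h1 : ∑ j, q j * l j ≤ ∑ j, q j * (a + K) :=
    Finset.sum_le_sum fun j _ => mul_le_mul_of_nonneg_left (hl j).2 (hq.1 j).le
  have h2 : ∑ j, q j * a ≤ ∑ j, q j * l j :=
    Finset.sum_le_sum fun j _ => mul_le_mul_of_nonneg_left (hl j).1 (hq.1 j).le
  rw [← Finset.sum_mul, hq.2, one_mul] at h1 h2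
  rw [abs_le]
  constructor <;> linarith [(hl i).1, (hl i).2]

/-- The right side is the chord of exp between -x and x. -/
theorem exp_mul_le_cosh_add_sinh {x d : ℝ} (hd : |d| ≤ 1) :
    Real.exp (x * d) ≤ Real.cosh x + d * Real.sinh x := by
  obtain ⟨h1, h2⟩ := abs_le.1 hd
  have h := convexOn_exp.2 (Set.mem_univ x) (Set.mem_univ (-x))
    (show 0 ≤ (1 + d) / 2 by linarith) (show 0 ≤ (1 - d) / 2 by linarith) (by ring)
  simp only [smul_eq_mul] at h
  rw [Real.cosh_eq, Real.sinh_eq]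
  have e : (1 + d) / 2 * x + (1 - d) / 2 * -x = x * d := by ring
  rw [e] at h
  linarith

/-- Hoeffding's lemma for a finite distribution. -/
theorem partition_le {q l : Fin m → ℝ} (hq : q ∈ posSimplex m) {a K : ℝ} (hK : 0 ≤ K)
    (hl : ∀ i, a ≤ l i ∧ l i ≤ a + K) :
    Real.log (∑ j, q j * Real.exp (l j)) ≤ ∑ j, q j * l j + K ^ 2 / 2 := by
  rw [Real.log_le_iff_le_exp (partition_pos hq l)]
  set μ := ∑ j, q j * l j with hμ
  -- Deviations from the mean lie in [-K, K], which yields K²/2 instead of the sharp K²/8. The term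
  -- linear in d averages to zero, so only cosh K remains.
  have hdev : ∀ j, ∃ d, |d| ≤ 1 ∧ l j - μ = K * d := by
    intro j
    have h := abs_sub_average_le hq hl j
    rcases hK.eq_or_lt with h0 | h0
    · refine ⟨0, by simp, ?_⟩
      rw [← h0] at h
      rw [mul_zero]
      exact abs_nonpos_iff.1 h
    · refine ⟨(l j - μ) / K, ?_, by field_simp⟩
      rw [abs_div, abs_of_pos h0]
      exact div_le_one_of_le₀ h hK
  choose d hd1 hd2 using hdev
  have hz : ∑ j, q j * (d j * Real.sinh K) = 0 := by
    rcases hK.eq_or_lt with h0 | h0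
    · simp [← h0]
    · have h1 : ∑ j, q j * (l j - μ) = 0 := by
        simp only [mul_sub]
        rw [Finset.sum_sub_distrib, ← Finset.sum_mul, hq.2, ← hμ]; ring
      have h2 : K * ∑ j, q j * d j = 0 := by
        rw [Finset.mul_sum, ← h1]
        exact Finset.sum_congr rfl fun j _ => by rw [hd2]; ring
      have h3 := (mul_eq_zero.1 h2).resolve_left h0.ne'
      simp only [← mul_assoc]
      rw [← Finset.sum_mul, h3, zero_mul]
  calc ∑ j, q j * Real.exp (l j) = Real.exp μ * ∑ j, q j * Real.exp (K * d j) := by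
        rw [Finset.mul_sum]
        refine Finset.sum_congr rfl fun j _ => ?_
        rw [← hd2 j, mul_left_comm, ← Real.exp_add]; ring_nf
    _ ≤ Real.exp μ * ∑ j, q j * (Real.cosh K + d j * Real.sinh K) := by
        refine mul_le_mul_of_nonneg_left ?_ (Real.exp_pos _).le
        exact Finset.sum_le_sum fun j _ =>
          mul_le_mul_of_nonneg_left (exp_mul_le_cosh_add_sinh (hd1 j)) (hq.1 j).le
    _ = Real.exp μ * Real.cosh K := by
        simp only [mul_add]
        rw [Finset.sum_add_distrib, hz, ← Finset.sum_mul, hq.2]; ring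
    _ ≤ Real.exp μ * Real.exp (K ^ 2 / 2) :=
        mul_le_mul_of_nonneg_left (Real.cosh_le_exp_half_sq K) (Real.exp_pos _).le
    _ = Real.exp (μ + K ^ 2 / 2) := (Real.exp_add _ _).symm

/-- The regret bound of multiplicative weights. -/
theorem hedge_regret {q l : ℕ → Fin m → ℝ} {T : ℕ} (hm : 1 ≤ m)
    (h0 : ∀ i, q 0 i = 1 / (m : ℝ)) (hstep : ∀ t < T, q (t + 1) = hedgeStep (q t) (l t))
    {a K : ℝ} (hK : 0 ≤ K) (hl : ∀ t < T, ∀ i, a ≤ l t i ∧ l t i ≤ a + K)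
    {u : Fin m → ℝ} (hu : u ∈ stdSimplex ℝ (Fin m)) :
    ∑ t ∈ Finset.range T, ∑ i, l t i * (u i - q t i) ≤ Real.log m + T * (K ^ 2 / 2) := by
  have hm' : (0 : ℝ) < m := by exact_mod_cast hm
  have hpos : ∀ t ≤ T, q t ∈ posSimplex m := by
    intro t
    induction t with
    | zero =>
      intro _
      refine ⟨fun i => by rw [h0]; positivity, ?_⟩
      simp only [h0, Finset.sum_const, Finset.card_univ, Fintype.card_fin, nsmul_eq_mul]
      field_simp
    | succ t ih => intro ht; rw [hstep t ht]; exact hedgeStep_mem (ih (Nat.le_of_succ_le ht)) _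
  -- The logarithm of the update is additive in the losses, so ∑ u log q serves as a telescoping
  -- potential. It starts at -log m and ends at most 0.
  have hsum : ∑ t ∈ Finset.range T, ∑ i, l t i * (u i - q t i) ≤ ∑ t ∈ Finset.range T,
      ((∑ i, u i * Real.log (q (t + 1) i) - ∑ i, u i * Real.log (q t i)) + K ^ 2 / 2) := by
    refine Finset.sum_le_sum fun t ht => ?_
    have ht' := Finset.mem_range.1 ht
    have hp := partition_le (hpos t ht'.le) hK (hl t ht')
    have e : ∑ i, u i * Real.log (q (t + 1) i) = ∑ i, u i * Real.log (q t i) + ∑ i, l t i * u i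
        - (∑ i, u i) * Real.log (∑ j, q t j * Real.exp (l t j)) := by
      rw [Finset.sum_mul, ← Finset.sum_add_distrib, ← Finset.sum_sub_distrib]
      refine Finset.sum_congr rfl fun i _ => ?_
      rw [hstep t ht', log_hedgeStep (hpos t ht'.le)]; ring
    have e2 : ∑ i, l t i * (u i - q t i) = ∑ i, l t i * u i - ∑ i, q t i * l t i := by
      rw [← Finset.sum_sub_distrib]; exact Finset.sum_congr rfl fun i _ => by ring
    rw [e, hu.2, e2]
    linarith
  rw [Finset.sum_add_distrib, Finset.sum_range_sub (fun t => ∑ i, u i * Real.log (q t i))] at hsum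
  simp only [Finset.sum_const, Finset.card_range, nsmul_eq_mul] at hsum
  have hT : ∑ i, u i * Real.log (q T i) ≤ 0 := by
    refine Finset.sum_nonpos fun i _ => mul_nonpos_of_nonneg_of_nonpos (hu.1 i) ?_
    have hq := hpos T le_rfl
    refine Real.log_nonpos (hq.1 i).le ?_
    rw [← hq.2]
    exact Finset.single_le_sum (fun j _ => (hq.1 j).le) (Finset.mem_univ i)
  have h00 : ∑ i, u i * Real.log (q 0 i) = - Real.log m := by
    simp only [h0]
    rw [← Finset.sum_mul, hu.2, one_div, Real.log_inv, one_mul]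
  linarith

end Hedge

/-! ### Measurability of minimizers and of mirror steps. -/

theorem measurable_comp_of_continuousOn {Ω : Type*} {_ : MeasurableSpace Ω} {F : Type*}
    [TopologicalSpace F] [MeasurableSpace F] [BorelSpace F] {S : Set F} {ν : F → ℝ}
    (hν : ContinuousOn ν S) {x : Ω → F} (hx : Measurable x) (hxS : ∀ ω, x ω ∈ S) :
    Measurable fun ω => ν (x ω) := by
  have h : Measurable (S.domRestrict ν) := hν.domRestrict.measurable
  exact h.comp (hx.subtype_mk (h := hxS))

section MeasurableArgmin

variable {Ω F : Type*} [NormedAddCommGroup F] [NormedSpace ℝ F] [FiniteDimensional ℝ F]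
  [MeasurableSpace F] [BorelSpace F]

/-- The unique minimizer of a Carathéodory function over a compact set is measurable. -/
theorem measurable_of_isArgmin_unique {_ : MeasurableSpace Ω} {S : Set F} (hS : IsCompact S)
    {f : Ω → F → ℝ} (hf : ∀ u ∈ S, Measurable fun ω => f ω u) (hc : ∀ ω, ContinuousOn (f ω) S)
    {x : Ω → F} (hx : ∀ ω, IsArgmin (f ω) S (x ω))
    (hu : ∀ ω y, IsArgmin (f ω) S y → y = x ω) : Measurable x := by
  have := FiniteDimensional.proper ℝ F
  have dense : ∀ A : Set F, ∃ d : Set F, d.Countable ∧ d ⊆ A ∧ A ⊆ closure d := fun A => by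
    obtain ⟨d, h1, h2, h3⟩ := (TopologicalSpace.IsSeparable.of_separableSpace
      A).exists_countable_dense_subset
    exact ⟨d, h2, h1, h3⟩
  refine measurable_of_isClosed fun C hC => ?_
  obtain ⟨d, hdc, hdS, hd⟩ := dense S
  obtain ⟨e, hec, heC, he⟩ := dense (S ∩ C)
  have hK : IsCompact (S ∩ C) := hS.inter_right hC
  -- The minimizer lies in C exactly when the infimum over S ∩ C does not exceed that over S. The
  -- slack 1/(n+1) lets both infima be tested on the countable dense sets e and d. In the converse
  -- direction, compactness provides a minimizer in S ∩ C, and uniqueness identifies it with x ω.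
  have key : x ⁻¹' C = ⋂ u ∈ d, ⋂ n : ℕ, ⋃ k ∈ e, {ω | f ω k < f ω u + 1 / ((n : ℝ) + 1)} := by
    ext ω
    simp only [Set.mem_preimage, Set.mem_iInter, Set.mem_iUnion, Set.mem_ofPred_eq, exists_prop]
    constructor
    · intro hxC u hud n
      have hn : (0 : ℝ) < 1 / ((n : ℝ) + 1) := by positivity
      have hlt : f ω (x ω) < f ω u + 1 / ((n : ℝ) + 1) :=
        lt_add_of_le_of_pos ((hx ω).2 u (hdS hud)) hn
      have hxcl : x ω ∈ closure e := he ⟨(hx ω).1, hxC⟩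
      have hcont : ContinuousWithinAt (f ω) e (x ω) :=
        ((hc ω) _ (hx ω).1).mono fun k hk => (heC hk).1
      have hev : ∀ᶠ k in 𝓝[e] (x ω), f ω k < f ω u + 1 / ((n : ℝ) + 1) :=
        hcont.eventually_lt_const hlt
      have hne : (𝓝[e] (x ω)).NeBot := mem_closure_iff_nhdsWithin_neBot.1 hxcl
      obtain ⟨k, hk1, hk2⟩ := (hev.and self_mem_nhdsWithin).exists
      exact ⟨k, hk2, hk1⟩
    · intro h
      have hdne : d.Nonempty := by
        rw [← closure_nonempty_iff]
        exact ⟨_, hd (hx ω).1⟩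
      obtain ⟨u0, hu0⟩ := hdne
      obtain ⟨k0, hk0, -⟩ := h u0 hu0 0
      obtain ⟨y, hyK, hy⟩ := hK.exists_isMinOn ⟨k0, heC hk0⟩
        ((hc ω).mono Set.inter_subset_left)
      have hyd : ∀ u ∈ d, f ω y ≤ f ω u := by
        intro u hud
        refine le_of_tendsto_of_tendsto' tendsto_const_nhds
          (by simpa only [add_zero] using
            (tendsto_one_div_add_atTop_nhds_zero_nat (𝕜 := ℝ)).const_add (f ω u))
          fun n => ?_
        obtain ⟨k, hk1, hk2⟩ := h u hud n
        exact (hy (heC hk1)).trans hk2.le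
      have hymin : IsArgmin (f ω) S y := by
        refine ⟨hyK.1, fun u huS => ?_⟩
        have hne : (𝓝[d] u).NeBot := mem_closure_iff_nhdsWithin_neBot.1 (hd huS)
        have hcont : Tendsto (f ω) (𝓝[d] u) (𝓝 (f ω u)) := ((hc ω) _ huS).mono hdS
        exact ge_of_tendsto hcont (eventually_nhdsWithin_of_forall hyd)
      rw [← hu ω y hymin]
      exact hyK.2
  rw [key]
  refine MeasurableSet.biInter hdc fun u hud => MeasurableSet.iInter fun n =>
    MeasurableSet.biUnion hec fun k hk => ?_
  exact measurableSet_lt (hf k (heC hk).1) ((hf u (hdS hud)).add_const _)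

/-- The derivative of ν at a varying point is reached as a pointwise limit of difference quotients,
which are measurable by continuity of ν on S. -/
theorem measurable_bregman {_ : MeasurableSpace Ω} {S : Set F} {ν : F → ℝ}
    (hν : IsDistanceGenerating S ν) {x : Ω → F} (hx : Measurable x)
    (hxp : ∀ ω, x ω ∈ proxDomain S ν) {u : F} (hu : u ∈ S) :
    Measurable fun ω => bregman S ν u (x ω) := by
  have hxS : ∀ ω, x ω ∈ S := fun ω => (hxp ω).choose_spec.1
  have hconv := hν.strongConvexOn.1
  have hd : Measurable fun ω => fderivWithin ℝ ν S (x ω) (u - x ω) := by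
    refine measurable_of_tendsto_metrizable (f := fun (n : ℕ) ω =>
      ((n : ℝ) + 1) * (ν (x ω + (1 / ((n : ℝ) + 1)) • (u - x ω)) - ν (x ω))) (fun n => ?_) ?_
    · refine Measurable.const_mul (Measurable.sub ?_ ?_) _
      · exact measurable_comp_of_continuousOn hν.continuousOn (by fun_prop)
          fun ω => convex_step_mem hconv (hxS ω) hu n
      · exact measurable_comp_of_continuousOn hν.continuousOn hx hxS
    · rw [tendsto_pi_nhds]
      exact fun ω => tendsto_segment_quotient hconv
        (hν.differentiableWithinAt _ (hxp ω)).hasFDerivWithinAt (hxS ω) hu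
  exact measurable_const.sub ((measurable_comp_of_continuousOn hν.continuousOn hx hxS).add hd)

theorem measurable_dual_apply {_ : MeasurableSpace Ω} {g : Ω → F →L[ℝ] ℝ} {x : Ω → F}
    (hg : Measurable g) (hx : Measurable x) : Measurable fun ω => g ω (x ω) := by
  have := FiniteDimensional.proper ℝ F
  have h : Continuous fun p : (F →L[ℝ] ℝ) × F => p.1 p.2 := by fun_prop
  exact h.measurable.comp (hg.prodMk hx)

/-- The iterate after a mirror step depends measurably on the data of the step. -/
theorem measurable_mirror_step {_ : MeasurableSpace Ω} {S : Set F} (hS : IsCompact S) {ν : F → ℝ}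
    (hν : IsDistanceGenerating S ν) {x y : Ω → F} {g : Ω → F →L[ℝ] ℝ} (hx : Measurable x)
    (hxp : ∀ ω, x ω ∈ proxDomain S ν) (hg : Measurable g)
    (hy : ∀ ω, IsArgmin (mirrorObjective S ν (x ω) (g ω)) S (y ω)) : Measurable y := by
  refine measurable_of_isArgmin_unique hS (fun u hu => ?_)
    (fun ω => hν.continuousOn_mirrorObjective (x ω) (g ω)) hy
    fun ω z hz => mirrorObjective_isArgmin_unique hν.strongConvexOn hz (hy ω)
  exact (measurable_dual_apply hg (hx.const_sub u)).add
    (measurable_bregman hν hx hxp hu)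

theorem measurable_hedgeStep {m : ℕ} : Measurable fun x : (Fin m → ℝ) × (Fin m → ℝ) =>
    hedgeStep x.1 x.2 := by
  unfold hedgeStep
  fun_prop

end MeasurableArgmin

/-! ### Existence of mirror steps and the ℓ¹ diameter of the simplex. -/

section MirrorStep

variable {F : Type*} [NormedAddCommGroup F] [NormedSpace ℝ F]

open Classical in
/-- A mirror descent step. -/
def mirrorStep (S : Set F) (ν : F → ℝ) (w : F) (g : F →L[ℝ] ℝ) : F :=
  -- The default w is never taken when S is compact, w ∈ S and ν is distance-generating.
  if h : ∃ u, IsArgmin (mirrorObjective S ν w g) S u then h.choose else w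

theorem isArgmin_mirrorStep {S : Set F} (hS : IsCompact S) {ν : F → ℝ}
    (hν : IsDistanceGenerating S ν) {w : F} (hw : w ∈ S) (g : F →L[ℝ] ℝ) :
    IsArgmin (mirrorObjective S ν w g) S (mirrorStep S ν w g) := by
  have h : ∃ u, IsArgmin (mirrorObjective S ν w g) S u := by
    obtain ⟨u, hu, hmin⟩ := hS.exists_isMinOn ⟨w, hw⟩ (hν.continuousOn_mirrorObjective w g)
    exact ⟨u, hu, fun y hy => hmin hy⟩
  rw [mirrorStep, dif_pos h]
  exact h.choose_spec

end MirrorStep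

section Simplex

variable {m : ℕ}

theorem sum_abs_sub_le_two {q r : Fin m → ℝ} (hq : q ∈ stdSimplex ℝ (Fin m))
    (hr : r ∈ stdSimplex ℝ (Fin m)) : ∑ i, |r i - q i| ≤ 2 := by
  calc ∑ i, |r i - q i| ≤ ∑ i, (r i + q i) := Finset.sum_le_sum fun i _ => by
        rw [abs_le]; constructor <;> linarith [hq.1 i, hr.1 i]
    _ = 2 := by rw [Finset.sum_add_distrib, hq.2, hr.2]; norm_num

/-- The ℓ¹ diameter 2 is traded for a multiple of √(log m), to match the noise bound: for m = 1 both
sides vanish, and for m ≥ 2 one has log m ≥ 1/2. -/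
theorem sum_abs_sub_le_sqrt_log {q r : Fin m → ℝ} (hq : q ∈ stdSimplex ℝ (Fin m))
    (hr : r ∈ stdSimplex ℝ (Fin m)) : ∑ i, |r i - q i| ≤ 2 * √2 * √(Real.log m) := by
  rcases lt_trichotomy m 1 with hm | rfl | hm
  · obtain rfl : m = 0 := by omega
    simp
  · have h1 := hq.2
    have h2 := hr.2
    simp only [Finset.univ_unique, Fin.default_eq_zero, Finset.sum_singleton] at h1 h2
    simp [h1, h2]
  · refine (sum_abs_sub_le_two hq hr).trans ?_
    have hm2 : (2 : ℝ) ≤ m := by exact_mod_cast hm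
    have hl : (1 / 2 : ℝ) ≤ Real.log m := by
      have := Real.log_le_log (by norm_num) hm2
      linarith [Real.log_two_gt_d9]
    rw [mul_assoc, ← Real.sqrt_mul (by norm_num)]
    have : 1 ≤ √(2 * Real.log m) := Real.one_le_sqrt.2 (by linarith)
    linarith

end Simplex

/-! ### Stochastic gradients, their noise, and the gradient inequality for the risk. -/

namespace Problem

variable {E : Type uE} {Z : Type uZ} [NormedAddCommGroup E] [NormedSpace ℝ E] [MeasurableSpace Z]
  {m : ℕ}

/-- The gradient of the risk. -/
def riskGrad (p : Problem E Z m) (i : Fin m) (w : E) : E →L[ℝ] ℝ := ∫ z, p.grad w z ∂(p.P i)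

/-- The error of the stochastic gradient in `w`. -/
def noiseW (p : Problem E Z m) (w : E) (q : Fin m → ℝ) (z : Fin m → Z) : E →L[ℝ] ℝ :=
  ∑ i, q i • (p.riskGrad i w - p.grad w (z i))

/-- The error of the stochastic gradient in `q`. -/
def noiseQ (p : Problem E Z m) (w : E) (z : Fin m → Z) : Fin m → ℝ :=
  fun i => p.risk i w - p.loss w (z i)

/-- The martingale increment of a round, where `x` consists of the iterates `w`, `q` and of the
comparison iterates for the noise in `w` and in `q`. -/
def noise (p : Problem E Z m) (x : E × (Fin m → ℝ) × E × (Fin m → ℝ)) (z : Fin m → Z) : ℝ :=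
  p.noiseW x.1 x.2.1 z (x.1 - x.2.2.1) + ∑ i, p.noiseQ x.1 z i * (x.2.2.2 i - x.2.1 i)

/-- The properties of almost every sample. -/
structure IsGoodSample (p : Problem E Z m) (G : ℝ) (z : Z) : Prop where
  loss_mem : ∀ w ∈ p.W, 0 ≤ p.loss w z ∧ p.loss w z ≤ 1
  hasGradient : ∀ w ∈ p.W, HasFDerivWithinAt (fun u => p.loss u z) (p.grad w z) p.W w
  norm_grad_le : ∀ w ∈ p.W, ‖p.grad w z‖ ≤ G

theorem norm_stochGradW_le {p : Problem E Z m} {G : ℝ} {w : E} (hw : w ∈ p.W) {q : Fin m → ℝ}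
    (hq : q ∈ stdSimplex ℝ (Fin m)) {z : Fin m → Z} (hz : ∀ i, p.IsGoodSample G (z i)) :
    ‖p.stochGradW w q z‖ ≤ G := by
  calc ‖p.stochGradW w q z‖ ≤ ∑ i, ‖q i • p.grad w (z i)‖ := norm_sum_le _ _
    _ ≤ ∑ i, q i * G := Finset.sum_le_sum fun i _ => by
        rw [norm_smul, Real.norm_of_nonneg (hq.1 i)]
        exact mul_le_mul_of_nonneg_left ((hz i).norm_grad_le w hw) (hq.1 i)
    _ = G := by rw [← Finset.sum_mul, hq.2, one_mul]

namespace Assumptions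

variable [MeasurableSpace E] {p : Problem E Z m} {D G : ℝ}

theorem ae_good (h : p.Assumptions D G) (i : Fin m) : ∀ᵐ z ∂(p.P i), p.IsGoodSample G z := by
  filter_upwards [h.loss_mem i, h.hasGradient i, h.norm_grad_le i] with z h1 h2 h3
  exact ⟨h1, h2, h3⟩

theorem nonneg_of_mem (h : p.Assumptions D G) (i : Fin m) {w : E} (hw : w ∈ p.W) : 0 ≤ G := by
  have := h.isProbabilityMeasure i
  obtain ⟨z, hz⟩ := (h.ae_good i).exists
  exact (norm_nonneg _).trans (hz.norm_grad_le w hw)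

theorem measurable_loss_right (h : p.Assumptions D G) (w : E) : Measurable (p.loss w) :=
  h.measurable_loss.comp measurable_prodMk_left

theorem integrable_loss (h : p.Assumptions D G) (i : Fin m) {w : E} (hw : w ∈ p.W) :
    Integrable (p.loss w) (p.P i) := by
  have := h.isProbabilityMeasure i
  refine Integrable.of_bound (h.measurable_loss_right w).aestronglyMeasurable 1 ?_
  filter_upwards [h.ae_good i] with z hz
  rw [Real.norm_eq_abs, abs_le]
  constructor <;> linarith [hz.loss_mem w hw]

theorem risk_mem (h : p.Assumptions D G) (i : Fin m) {w : E} (hw : w ∈ p.W) :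
    0 ≤ p.risk i w ∧ p.risk i w ≤ 1 := by
  have := h.isProbabilityMeasure i
  refine ⟨integral_nonneg_of_ae ?_, ?_⟩
  · filter_upwards [h.ae_good i] with z hz using (hz.loss_mem w hw).1
  · have h1 : p.risk i w ≤ ∫ _, (1 : ℝ) ∂(p.P i) := by
      refine integral_mono_ae (h.integrable_loss i hw) (integrable_const _) ?_
      filter_upwards [h.ae_good i] with z hz using (hz.loss_mem w hw).2
    simpa using h1

theorem norm_riskGrad_le (h : p.Assumptions D G) (i : Fin m) {w : E} (hw : w ∈ p.W) :
    ‖p.riskGrad i w‖ ≤ G := by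
  have := h.isProbabilityMeasure i
  have h1 := norm_integral_le_of_norm_le_const (μ := p.P i) (f := p.grad w) (C := G)
    (by filter_upwards [h.ae_good i] with z hz using hz.norm_grad_le w hw)
  simpa [riskGrad] using h1

theorem measurable_stochGradQ (h : p.Assumptions D G) :
    Measurable fun x : E × (Fin m → Z) => p.stochGradQ x.1 x.2 := by
  refine measurable_pi_lambda _ fun i => ?_
  exact h.measurable_loss.comp (by fun_prop : Measurable fun x : E × (Fin m → Z) => (x.1, x.2 i))

theorem measurable_risk (h : p.Assumptions D G) (i : Fin m) : Measurable (p.risk i) := by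
  have := h.isProbabilityMeasure i
  exact (h.measurable_loss.stronglyMeasurable.integral_prod_right' (ν := p.P i)).measurable

theorem measurable_noiseQ (h : p.Assumptions D G) :
    Measurable fun x : E × (Fin m → Z) => p.noiseQ x.1 x.2 := by
  refine measurable_pi_lambda _ fun i => ?_
  exact ((h.measurable_risk i).comp measurable_fst).sub
    ((measurable_pi_apply i).comp h.measurable_stochGradQ)

theorem abs_noiseQ_le (h : p.Assumptions D G) {w : E} (hw : w ∈ p.W) {z : Fin m → Z}
    (hz : ∀ i, p.IsGoodSample G (z i)) (i : Fin m) : |p.noiseQ w z i| ≤ 1 := by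
  have h1 := h.risk_mem i hw
  have h2 := (hz i).loss_mem w hw
  rw [noiseQ, abs_le]
  constructor <;> linarith

theorem norm_noiseW_le (h : p.Assumptions D G) {w : E} (hw : w ∈ p.W) {q : Fin m → ℝ}
    (hq : q ∈ stdSimplex ℝ (Fin m)) {z : Fin m → Z} (hz : ∀ i, p.IsGoodSample G (z i)) :
    ‖p.noiseW w q z‖ ≤ 2 * G := by
  calc ‖p.noiseW w q z‖ ≤ ∑ i, ‖q i • (p.riskGrad i w - p.grad w (z i))‖ := norm_sum_le _ _
    _ ≤ ∑ i, q i * (2 * G) := Finset.sum_le_sum fun i _ => by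
        rw [norm_smul, Real.norm_of_nonneg (hq.1 i)]
        refine mul_le_mul_of_nonneg_left ((norm_sub_le _ _).trans ?_) (hq.1 i)
        linarith [(hz i).norm_grad_le w hw, h.norm_riskGrad_le i hw]
    _ = 2 * G := by rw [← Finset.sum_mul, hq.2, one_mul]

theorem abs_noise_le (h : p.Assumptions D G) (hm : 1 ≤ m) {x0 : E} (hx0 : IsArgmin p.ν p.W x0)
    {x : E × (Fin m → ℝ) × E × (Fin m → ℝ)} (hw : x.1 ∈ p.W)
    (hq : x.2.1 ∈ stdSimplex ℝ (Fin m)) (hv : x.2.2.1 ∈ p.W)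
    (hr : x.2.2.2 ∈ stdSimplex ℝ (Fin m)) {z : Fin m → Z} (hz : ∀ i, p.IsGoodSample G (z i)) :
    |p.noise x z| ≤ 2 * √(10 * (D ^ 2 * G ^ 2 + Real.log m)) := by
  have hG := h.nonneg_of_mem ⟨0, hm⟩ hw
  have hlog : 0 ≤ Real.log m := Real.log_natCast_nonneg m
  have h1 : |p.noiseW x.1 x.2.1 z (x.1 - x.2.2.1)| ≤ 2 * G * (2 * √2 * |D|) :=
    ((p.noiseW x.1 x.2.1 z).le_opNorm _).trans (mul_le_mul (h.norm_noiseW_le hw hq hz)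
      (norm_sub_le_of_argmin h.distanceGenerating.strongConvexOn h.diameter hx0 hw hv)
      (norm_nonneg _) (by positivity))
  have h2 : |∑ i, p.noiseQ x.1 z i * (x.2.2.2 i - x.2.1 i)| ≤ 2 * √2 * √(Real.log m) := by
    refine (Finset.abs_sum_le_sum_abs _ _).trans (le_trans ?_ (sum_abs_sub_le_sqrt_log hq hr))
    refine Finset.sum_le_sum fun i _ => ?_
    rw [abs_mul]
    exact mul_le_of_le_one_left (abs_nonneg _) (h.abs_noiseQ_le hw hz i)
  have h3 : 2 * G * (2 * √2 * |D|) + 2 * √2 * √(Real.log m) ≤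
      2 * √(10 * (D ^ 2 * G ^ 2 + Real.log m)) := by
    have e1 : √2 ^ 2 = 2 := Real.sq_sqrt (by norm_num)
    have e2 : √(Real.log m) ^ 2 = Real.log m := Real.sq_sqrt hlog
    have e3 : √(10 * (D ^ 2 * G ^ 2 + Real.log m)) ^ 2 = 10 * (D ^ 2 * G ^ 2 + Real.log m) :=
      Real.sq_sqrt (by positivity)
    refine abs_le_of_sq_le_sq' ?_ (by positivity) |>.2
    have e4 : (2 * G * (2 * √2 * |D|) + 2 * √2 * √(Real.log m)) ^ 2 =
        √2 ^ 2 * (4 * (2 * (G * |D|) + √(Real.log m)) ^ 2) := by ring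
    rw [e4, mul_pow, e1, e3]
    have e5 : D ^ 2 * G ^ 2 = (G * |D|) ^ 2 := by rw [mul_pow, sq_abs]; ring
    rw [e5]
    nth_rewrite 2 [← e2]
    -- With a = G|D| and b = √(log m) this is Cauchy–Schwarz, (2a + b)² ≤ 5(a² + b²), whose defect
    -- is (a - 2b)².
    nlinarith [sq_nonneg (G * |D| - 2 * √(Real.log m))]
  exact (abs_add_le _ _).trans ((add_le_add h1 h2).trans h3)

theorem stronglyMeasurable_grad [FiniteDimensional ℝ E] (h : p.Assumptions D G) :
    StronglyMeasurable fun x : E × Z => p.grad x.1 x.2 := by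
  have := FiniteDimensional.proper ℝ (E →L[ℝ] ℝ)
  exact h.measurable_grad.stronglyMeasurable

variable [FiniteDimensional ℝ E]

theorem integrable_grad (h : p.Assumptions D G) (i : Fin m) {w : E} (hw : w ∈ p.W) :
    Integrable (p.grad w) (p.P i) := by
  have := h.isProbabilityMeasure i
  refine Integrable.of_bound (h.stronglyMeasurable_grad.comp_measurable
    measurable_prodMk_left).aestronglyMeasurable G ?_
  filter_upwards [h.ae_good i] with z hz using hz.norm_grad_le w hw

theorem measurable_riskGrad (h : p.Assumptions D G) (i : Fin m) : Measurable (p.riskGrad i) := by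
  have := h.isProbabilityMeasure i
  exact (h.stronglyMeasurable_grad.integral_prod_right' (ν := p.P i)).measurable

/-- The gradient inequality of the convex risk, which includes differentiation under the
integral. -/
theorem risk_sub_le (h : p.Assumptions D G) (i : Fin m) {w u : E} (hw : w ∈ p.W) (hu : u ∈ p.W) :
    p.risk i w - p.risk i u ≤ p.riskGrad i w (w - u) := by
  have := h.isProbabilityMeasure i
  -- Convexity is assumed of the risk and not of each loss, so the inequality is obtained after
  -- integration. The mean value inequality dominates the difference quotients by G‖u - w‖.
  have hlim : Tendsto (fun n : ℕ => ∫ z, ((n : ℝ) + 1) *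
      (p.loss (w + (1 / ((n : ℝ) + 1)) • (u - w)) z - p.loss w z) ∂(p.P i)) atTop
      (𝓝 (∫ z, p.grad w z (u - w) ∂(p.P i))) := by
    refine tendsto_integral_of_dominated_convergence (fun _ => G * ‖u - w‖) (fun n => ?_)
      (integrable_const _) (fun n => ?_) ?_
    · exact (((h.measurable_loss_right _).sub
        (h.measurable_loss_right _)).const_mul _).aestronglyMeasurable
    · filter_upwards [h.ae_good i] with z hz
      have hn : (0 : ℝ) < (n : ℝ) + 1 := by positivity
      have hb := h.convex.norm_image_sub_le_of_norm_hasFDerivWithin_le hz.hasGradient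
        hz.norm_grad_le hw (convex_step_mem h.convex hw hu n)
      rw [norm_mul, Real.norm_of_nonneg hn.le]
      refine (mul_le_mul_of_nonneg_left hb hn.le).trans (le_of_eq ?_)
      rw [add_sub_cancel_left, norm_smul, Real.norm_of_nonneg (by positivity)]
      field_simp
    · filter_upwards [h.ae_good i] with z hz
      exact tendsto_segment_quotient h.convex (hz.hasGradient w hw) hw hu
  have hle : ∫ z, p.grad w z (u - w) ∂(p.P i) ≤ p.risk i u - p.risk i w := by
    refine le_of_tendsto' hlim fun n => ?_
    have hn : (0 : ℝ) < (n : ℝ) + 1 := by positivity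
    have hmem := convex_step_mem h.convex hw hu n
    rw [integral_const_mul, integral_sub (h.integrable_loss i hmem) (h.integrable_loss i hw)]
    change ((n : ℝ) + 1) * (p.risk i _ - p.risk i w) ≤ _
    set s := 1 / ((n : ℝ) + 1) with hs
    have hs1 : s ≤ 1 := by
      rw [hs, div_le_one hn]; linarith [(Nat.cast_nonneg n : (0 : ℝ) ≤ n)]
    have hs0 : 0 ≤ s := by positivity
    have hc := (h.convexOn_risk i).2 hw hu (sub_nonneg.2 hs1) hs0 (by ring)
    have e : (1 - s) • w + s • u = w + s • (u - w) := by
      simp only [sub_smul, smul_sub, one_smul]; abel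
    rw [e] at hc
    simp only [smul_eq_mul] at hc
    have e1 : ((n : ℝ) + 1) * s = 1 := by rw [hs]; field_simp
    calc ((n : ℝ) + 1) * (p.risk i (w + s • (u - w)) - p.risk i w)
        ≤ ((n : ℝ) + 1) * (s * (p.risk i u - p.risk i w)) :=
          mul_le_mul_of_nonneg_left (by linarith) hn.le
      _ = (((n : ℝ) + 1) * s) * (p.risk i u - p.risk i w) := by ring
      _ = _ := by rw [e1, one_mul]
  rw [← ContinuousLinearMap.integral_apply (h.integrable_grad i hw)] at hle
  change p.riskGrad i w (u - w) ≤ _ at hle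
  rw [map_sub] at hle ⊢
  linarith

theorem measurable_stochGradW (h : p.Assumptions D G) :
    Measurable fun x : E × (Fin m → ℝ) × (Fin m → Z) => p.stochGradW x.1 x.2.1 x.2.2 := by
  have := FiniteDimensional.proper ℝ (E →L[ℝ] ℝ)
  unfold stochGradW
  refine Finset.measurable_sum _ fun i _ => Measurable.smul
    (by fun_prop : Measurable fun x : E × (Fin m → ℝ) × (Fin m → Z) => x.2.1 i) ?_
  exact h.measurable_grad.comp
    (by fun_prop : Measurable fun x : E × (Fin m → ℝ) × (Fin m → Z) => (x.1, x.2.2 i))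

theorem measurable_noiseW (h : p.Assumptions D G) :
    Measurable fun x : E × (Fin m → ℝ) × (Fin m → Z) => p.noiseW x.1 x.2.1 x.2.2 := by
  have := FiniteDimensional.proper ℝ (E →L[ℝ] ℝ)
  unfold noiseW
  refine Finset.measurable_sum _ fun i _ => Measurable.smul
    (by fun_prop : Measurable fun x : E × (Fin m → ℝ) × (Fin m → Z) => x.2.1 i)
    (Measurable.sub ?_ ?_)
  · exact (h.measurable_riskGrad i).comp measurable_fst
  · exact h.measurable_grad.comp
      (by fun_prop : Measurable fun x : E × (Fin m → ℝ) × (Fin m → Z) => (x.1, x.2.2 i))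

/-- With the state frozen, the noise is a sum of centred functions, each of a single sample. -/
theorem integral_noise (h : p.Assumptions D G) {x : E × (Fin m → ℝ) × E × (Fin m → ℝ)}
    (hw : x.1 ∈ p.W) : ∫ z, p.noise x z ∂(Measure.pi p.P) = 0 := by
  have := h.isProbabilityMeasure
  set a := x.1 - x.2.2.1
  have hg : ∀ i, Integrable (fun z => p.riskGrad i x.1 a - p.grad x.1 z a) (p.P i) := fun i =>
    (integrable_const _).sub ((h.integrable_grad i hw).apply_continuousLinearMap a)
  have hl : ∀ i, Integrable (fun z => p.risk i x.1 - p.loss x.1 z) (p.P i) := fun i =>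
    (integrable_const _).sub (h.integrable_loss i hw)
  have hg0 : ∀ i, ∫ z, (p.riskGrad i x.1 a - p.grad x.1 z a) ∂(p.P i) = 0 := fun i => by
    rw [integral_sub (integrable_const _) ((h.integrable_grad i hw).apply_continuousLinearMap a),
      ← ContinuousLinearMap.integral_apply (h.integrable_grad i hw)]
    simp [riskGrad]
  have hl0 : ∀ i, ∫ z, (p.risk i x.1 - p.loss x.1 z) ∂(p.P i) = 0 := fun i => by
    rw [integral_sub (integrable_const _) (h.integrable_loss i hw)]
    simp [risk]
  have e : p.noise x = fun z => ∑ i, (x.2.1 i * (p.riskGrad i x.1 a - p.grad x.1 (z i) a)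
      + (p.risk i x.1 - p.loss x.1 (z i)) * (x.2.2.2 i - x.2.1 i)) := by
    funext z
    simp only [noise, noiseW, noiseQ, sum_apply, smul_apply, sub_apply, smul_eq_mul]
    rw [← Finset.sum_add_distrib]
  have hgi : ∀ i, Integrable (fun z : Fin m → Z =>
      x.2.1 i * (p.riskGrad i x.1 a - p.grad x.1 (z i) a)) (Measure.pi p.P) := fun i =>
    (integrable_comp_eval (μ := p.P) (i := i) (hg i)).const_mul (x.2.1 i)
  have hli : ∀ i, Integrable (fun z : Fin m → Z =>
      (p.risk i x.1 - p.loss x.1 (z i)) * (x.2.2.2 i - x.2.1 i)) (Measure.pi p.P) := fun i =>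
    (integrable_comp_eval (μ := p.P) (i := i) (hl i)).mul_const (x.2.2.2 i - x.2.1 i)
  rw [e]
  refine (integral_finsetSum _ fun i _ => (hgi i).add (hli i)).trans ?_
  refine Finset.sum_eq_zero fun i _ => ?_
  refine (integral_add (hgi i) (hli i)).trans ?_
  have hgp := (integral_comp_eval (μ := p.P) (i := i) (hg i).aestronglyMeasurable).trans (hg0 i)
  have hlp := (integral_comp_eval (μ := p.P) (i := i) (hl i).aestronglyMeasurable).trans (hl0 i)
  rw [integral_const_mul, integral_mul_const, hgp, hlp, mul_zero, zero_mul, add_zero]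

variable [BorelSpace E]

theorem measurable_noise (h : p.Assumptions D G) :
    Measurable fun x : (E × (Fin m → ℝ) × E × (Fin m → ℝ)) × (Fin m → Z) => p.noise x.1 x.2 := by
  have := FiniteDimensional.proper ℝ E
  unfold noise
  refine Measurable.add ?_ (Finset.measurable_sum _ fun i _ => Measurable.mul ?_ (by fun_prop))
  · refine measurable_dual_apply (h.measurable_noiseW.comp (by fun_prop :
      Measurable fun x : (E × (Fin m → ℝ) × E × (Fin m → ℝ)) × (Fin m → Z) =>
        (x.1.1, x.1.2.1, x.2))) ?_
    fun_prop
  · exact (measurable_pi_apply i).comp (h.measurable_noiseQ.comp (by fun_prop :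
      Measurable fun x : (E × (Fin m → ℝ) × E × (Fin m → ℝ)) × (Fin m → Z) => (x.1.1, x.2)))

end Assumptions

end Problem

/-! ### Averages, and regret bounds for the chosen step sizes. -/

section Averages

theorem average_mem {F : Type*} [AddCommGroup F] [Module ℝ F] {S : Set F} (hS : Convex ℝ S)
    {T : ℕ} (hT : 1 ≤ T) {x : ℕ → F} (hx : ∀ t < T, x t ∈ S) : average T x ∈ S := by
  have hT' : (T : ℝ) ≠ 0 := by positivity
  rw [average, Finset.smul_sum]
  refine hS.sum_mem (fun _ _ => by positivity) ?_ fun t ht => hx t (Finset.mem_range.1 ht)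
  simp [hT']

theorem ConvexOn.map_average_le {F : Type*} [AddCommGroup F] [Module ℝ F] {S : Set F} {f : F → ℝ}
    (hf : ConvexOn ℝ S f) {T : ℕ} (hT : 1 ≤ T) {x : ℕ → F} (hx : ∀ t < T, x t ∈ S) :
    f (average T x) ≤ average T fun t => f (x t) := by
  have hT' : (T : ℝ) ≠ 0 := by positivity
  rw [average, average, Finset.smul_sum, Finset.smul_sum]
  refine hf.map_sum_le (fun _ _ => by positivity) ?_ fun t ht => hx t (Finset.mem_range.1 ht)
  simp [hT']

/-- The value of the regret bound for the chosen step sizes. -/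
theorem step_constant_bound {L c : ℝ} {T : ℕ} (hL : 0 ≤ L) (hT : 1 ≤ T)
    (hc : c = √(8 / (5 * T * L))) : 4 * (1 / c) + T * (5 / 2 * c * L) ≤ T * (2 * √(10 * L / T)) := by
  have hT' : (0 : ℝ) < T := by positivity
  rcases hL.eq_or_lt with h0 | h0
  -- For L = 0 division by zero gives c = 0 and 1 / c = 0, so both sides vanish.
  · rw [hc, ← h0]; simp
  · have hc0 : 0 < c := by rw [hc]; positivity
    have hc2 : c ^ 2 = 8 / (5 * T * L) := by rw [hc]; exact Real.sq_sqrt (by positivity)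
    -- This c balances the two terms on the left: both equal 4 / c.
    have e1 : √(10 * L / T) = 4 / (T * c) := by
      rw [Real.sqrt_eq_iff_eq_sq (by positivity) (by positivity), div_pow, mul_pow, hc2]
      field_simp
      norm_num
    have e2 : T * (5 / 2 * c * L) = 4 / c := by
      rw [eq_div_iff hc0.ne']
      have : T * (5 / 2 * c * L) * c = 5 / 2 * T * L * c ^ 2 := by ring
      rw [this, hc2]
      field_simp
      norm_num
    rw [e1, e2]
    refine le_of_eq ?_
    field_simp
    norm_num

end Averages

section ScaledRegret

/-- The regret bound is divided by the step size D²c. In the degenerate case D²K² = 0 the step may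
be zero, but then the gradients vanish or S is a point, so the regret is at most 0 directly. -/
theorem mirror_regret_scaled {F : Type*} [NormedAddCommGroup F] [NormedSpace ℝ F] {S : Set F}
    {ν : F → ℝ} (hν : IsDistanceGenerating S ν) {D K c : ℝ}
    (hD : ∀ u ∈ S, ∀ v ∈ S, ν u - ν v ≤ D ^ 2) {w : ℕ → F} {g : ℕ → F →L[ℝ] ℝ} {T : ℕ}
    (hc : 0 ≤ c) (hc' : D ^ 2 * K ^ 2 ≠ 0 → 0 < c) (h0 : IsArgmin ν S (w 0))
    (hstep : ∀ t < T, IsArgmin (mirrorObjective S ν (w t) ((D ^ 2 * c) • g t)) S (w (t + 1)))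
    (hg : ∀ t < T, ‖g t‖ ≤ K) {u : F} (hu : u ∈ S) :
    ∑ t ∈ Finset.range T, g t (w t - u) ≤ 1 / c + T * (1 / 2 * (c * (D ^ 2 * K ^ 2))) := by
  have hw : ∀ t < T, w t ∈ S := fun t ht => by
    cases t with
    | zero => exact h0.1
    | succ t => exact (hstep t (Nat.lt_of_succ_lt ht)).1
  by_cases hz : D ^ 2 * K ^ 2 = 0
  · rw [hz]
    have hKD : |K| * |D| = 0 := by
      rw [← abs_mul, abs_eq_zero, ← sq_eq_zero_iff, mul_pow, mul_comm, hz]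
    have : ∑ t ∈ Finset.range T, g t (w t - u) ≤ 0 := by
      refine Finset.sum_nonpos fun t ht => ?_
      have ht := Finset.mem_range.1 ht
      have h1 := (g t).le_opNorm (w t - u)
      have h2 := norm_sub_le_of_argmin hν.strongConvexOn hD h0 (hw t ht) hu
      have h3 : ‖g t‖ * ‖w t - u‖ ≤ |K| * (2 * √2 * |D|) :=
        mul_le_mul ((hg t ht).trans (le_abs_self K)) h2 (norm_nonneg _) (abs_nonneg _)
      have h4 : |K| * (2 * √2 * |D|) = 2 * √2 * (|K| * |D|) := by ring
      rw [h4, hKD] at h3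
      exact (le_abs_self _).trans (h1.trans (h3.trans (by simp)))
    refine this.trans ?_
    have : 0 ≤ 1 / c := by positivity
    simpa using this
  · have hc0 := hc' hz
    have hD0 : D ≠ 0 := fun h => hz (by simp [h])
    have hη : 0 < D ^ 2 * c := by positivity
    have h := mirror_regret hν hD (K := D ^ 2 * c * K) h0 hstep (fun t ht => by
      rw [norm_smul, Real.norm_of_nonneg hη.le]
      exact mul_le_mul_of_nonneg_left (hg t ht) hη.le) hu
    simp only [smul_apply, smul_eq_mul] at h
    rw [← Finset.mul_sum] at h
    refine le_of_mul_le_mul_left (h.trans (le_of_eq ?_)) hη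
    field_simp

/-- As for `mirror_regret_scaled`; here the degenerate case log m = 0 means m = 1, where the simplex
is a point. -/
theorem hedge_regret_scaled {m : ℕ} {q l : ℕ → Fin m → ℝ} {T : ℕ} {c : ℝ} (hm : 1 ≤ m)
    (hc : 0 ≤ c) (hc' : Real.log m ≠ 0 → 0 < c) (h0 : ∀ i, q 0 i = 1 / (m : ℝ))
    (hstep : ∀ t < T, q (t + 1) = hedgeStep (q t) (fun i => Real.log m * c * l t i))
    (hq : ∀ t < T, q t ∈ posSimplex m)
    {a K : ℝ} (hK : 0 ≤ K) (hl : ∀ t < T, ∀ i, a ≤ l t i ∧ l t i ≤ a + K)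
    {u : Fin m → ℝ} (hu : u ∈ stdSimplex ℝ (Fin m)) :
    ∑ t ∈ Finset.range T, ∑ i, l t i * (u i - q t i) ≤
      1 / c + T * (1 / 2 * (c * (Real.log m * K ^ 2))) := by
  have hlog : 0 ≤ Real.log m := Real.log_natCast_nonneg m
  by_cases hz : Real.log m = 0
  · have hm1 : m = 1 := by
      have hmpos : (0 : ℝ) < m := by exact_mod_cast hm
      have := Real.eq_one_of_pos_of_log_eq_zero hmpos hz
      exact_mod_cast this
    subst hm1
    have : ∑ t ∈ Finset.range T, ∑ i, l t i * (u i - q t i) = 0 := by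
      refine Finset.sum_eq_zero fun t ht => ?_
      have h1 := hu.2
      have h2 := (hq t (Finset.mem_range.1 ht)).2
      simp only [Finset.univ_unique, Fin.default_eq_zero, Finset.sum_singleton] at h1 h2
      simp [h1, h2]
    rw [this, hz]
    positivity
  · have hc0 := hc' hz
    have hlog0 : 0 < Real.log m := lt_of_le_of_ne hlog (Ne.symm hz)
    have hη : 0 < Real.log m * c := by positivity
    have h := hedge_regret hm h0 hstep (a := Real.log m * c * a) (K := Real.log m * c * K)
      (by positivity) (fun t ht i => ⟨mul_le_mul_of_nonneg_left (hl t ht i).1 hη.le, by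
        rw [← mul_add]; exact mul_le_mul_of_nonneg_left (hl t ht i).2 hη.le⟩) hu
    have e : ∑ t ∈ Finset.range T, ∑ i, Real.log m * c * l t i * (u i - q t i) =
        Real.log m * c * ∑ t ∈ Finset.range T, ∑ i, l t i * (u i - q t i) := by
      simp only [Finset.mul_sum, mul_assoc]
    rw [e] at h
    refine le_of_mul_le_mul_left (h.trans (le_of_eq ?_)) hη
    field_simp

end ScaledRegret

/-! ### The error function, the comparison iterates and the pathwise error bound. -/

namespace Problem

variable {E : Type uE} {Z : Type uZ} [NormedAddCommGroup E] [NormedSpace ℝ E] [MeasurableSpace Z]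
  {m : ℕ}

theorem phi_average (p : Problem E Z m) (w : E) (T : ℕ) (q : ℕ → Fin m → ℝ) :
    p.phi w (average T q) = average T fun t => p.phi w (q t) := by
  simp only [phi, average, Pi.smul_apply, Finset.sum_apply, smul_eq_mul, Finset.mul_sum,
    Finset.sum_mul]
  rw [Finset.sum_comm]
  simp only [mul_assoc]

theorem stdSimplex_nonempty (hm : 1 ≤ m) : (stdSimplex ℝ (Fin m)).Nonempty :=
  ⟨_, single_mem_stdSimplex ℝ (⟨0, hm⟩ : Fin m)⟩

theorem err_le_of_forall {p : Problem E Z m} (hm : 1 ≤ m) (hW : p.W.Nonempty) {w : E}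
    {q : Fin m → ℝ} {B : ℝ}
    (hB : ∀ r ∈ stdSimplex ℝ (Fin m), ∀ u ∈ p.W, p.phi w r - p.phi u q ≤ B) : p.err w q ≤ B := by
  rw [err, sub_le_iff_le_add]
  refine csSup_le ((stdSimplex_nonempty hm).image _) ?_
  rintro _ ⟨r, hr, rfl⟩
  rw [← sub_le_iff_le_add']
  refine le_csInf (hW.image _) ?_
  rintro _ ⟨u, hu, rfl⟩
  simp only
  linarith [hB r hr u hu]

theorem univ_fin_nonempty (hm : 1 ≤ m) : (Finset.univ : Finset (Fin m)).Nonempty :=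
  ⟨⟨0, hm⟩, Finset.mem_univ _⟩

/-- A linear function on the simplex is maximal at a vertex; the finite maximum is then measurable
in w. -/
theorem sSup_phi_eq (p : Problem E Z m) (hm : 1 ≤ m) (w : E) :
    sSup ((fun r => p.phi w r) '' stdSimplex ℝ (Fin m)) =
      Finset.univ.sup' (univ_fin_nonempty hm) fun i => p.risk i w := by
  refine IsGreatest.csSup_eq ⟨?_, ?_⟩
  · obtain ⟨i, -, hi⟩ := Finset.exists_mem_eq_sup' (univ_fin_nonempty hm) fun i => p.risk i w
    rw [hi]
    refine ⟨Pi.single i 1, single_mem_stdSimplex ℝ i, ?_⟩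
    simp [phi, Pi.single_apply]
  · rintro _ ⟨r, hr, rfl⟩
    set s := Finset.univ.sup' (univ_fin_nonempty hm) fun i => p.risk i w with hs
    calc ∑ i, r i * p.risk i w ≤ ∑ i, r i * s := Finset.sum_le_sum fun i _ =>
          mul_le_mul_of_nonneg_left
            (Finset.le_sup' (fun i => p.risk i w) (Finset.mem_univ i)) (hr.1 i)
      _ = s := by rw [← Finset.sum_mul, hr.2, one_mul]

section Error

variable [MeasurableSpace E] {p : Problem E Z m} {D G : ℝ}

theorem Assumptions.phi_mem (h : p.Assumptions D G) {w : E} (hw : w ∈ p.W) {q : Fin m → ℝ}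
    (hq : q ∈ stdSimplex ℝ (Fin m)) : 0 ≤ p.phi w q ∧ p.phi w q ≤ 1 := by
  refine ⟨Finset.sum_nonneg fun i _ => mul_nonneg (hq.1 i) (h.risk_mem i hw).1, ?_⟩
  rw [← hq.2]
  exact Finset.sum_le_sum fun i _ => mul_le_of_le_one_right (hq.1 i) (h.risk_mem i hw).2

theorem Assumptions.abs_err_le_one (h : p.Assumptions D G) {w : E} (hw : w ∈ p.W)
    {q : Fin m → ℝ} (hq : q ∈ stdSimplex ℝ (Fin m)) : |p.err w q| ≤ 1 := by
  have hS : ∀ x ∈ (fun r => p.phi w r) '' stdSimplex ℝ (Fin m), 0 ≤ x ∧ x ≤ 1 := by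
    rintro _ ⟨r, hr, rfl⟩; exact h.phi_mem hw hr
  have hI : ∀ x ∈ (fun u => p.phi u q) '' p.W, 0 ≤ x ∧ x ≤ 1 := by
    rintro _ ⟨u, hu, rfl⟩; exact h.phi_mem hu hq
  have hI' : (fun u => p.phi u q) '' p.W ≠ ∅ := (Set.Nonempty.image _ ⟨w, hw⟩).ne_empty
  have s0 := Real.sSup_nonneg fun x hx => (hS x hx).1
  have s1 := Real.sSup_le (fun x hx => (hS x hx).2) zero_le_one
  have i0 := Real.sInf_nonneg fun x hx => (hI x hx).1
  have i1 : sInf ((fun u => p.phi u q) '' p.W) ≤ 1 :=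
    (csInf_le ⟨0, fun x hx => (hI x hx).1⟩ ⟨w, hw, rfl⟩).trans (h.phi_mem hw hq).2
  rw [err, abs_le]
  constructor <;> linarith

/-- An infimum over an uncountable W need not preserve measurability. Since the risks lie in [0, 1],
all functions of q involved are m-Lipschitz, and so is their infimum. -/
theorem Assumptions.continuous_sInf_phi (h : p.Assumptions D G) (hW : p.W.Nonempty) :
    Continuous fun q : Fin m → ℝ => sInf ((fun u => p.phi u q) '' p.W) := by
  have hb : ∀ q : Fin m → ℝ, BddBelow ((fun u => p.phi u q) '' p.W) := by
    refine fun q => ⟨- ∑ i, |q i|, ?_⟩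
    rintro _ ⟨u, hu, rfl⟩
    simp only [phi]
    rw [← Finset.sum_neg_distrib]
    refine Finset.sum_le_sum fun i _ => ?_
    obtain ⟨h1, h2⟩ := h.risk_mem i hu
    have := neg_abs_le (q i)
    nlinarith [abs_nonneg (q i)]
  refine (LipschitzWith.of_le_add_mul (m : NNReal) fun q r => ?_).continuous
  rw [← sub_le_iff_le_add]
  refine le_csInf (hW.image _) ?_
  rintro _ ⟨u, hu, rfl⟩
  rw [sub_le_iff_le_add]
  refine (csInf_le (hb q) ⟨u, hu, rfl⟩).trans ?_
  have h1 : ∑ i, (q i - r i) * p.risk i u ≤ ∑ _i : Fin m, dist q r := by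
    refine Finset.sum_le_sum fun i _ => ?_
    obtain ⟨h1, h2⟩ := h.risk_mem i hu
    have h3 : |q i - r i| ≤ dist q r := dist_le_pi_dist q r i
    calc _ ≤ |q i - r i| * p.risk i u := mul_le_mul_of_nonneg_right (le_abs_self _) h1
      _ ≤ |q i - r i| := mul_le_of_le_one_right (abs_nonneg _) h2
      _ ≤ _ := h3
  have h2 : ∑ i, (q i - r i) * p.risk i u = p.phi u q - p.phi u r := by
    simp only [phi, ← Finset.sum_sub_distrib, sub_mul]
  rw [h2] at h1
  simp only [Finset.sum_const, Finset.card_univ, Fintype.card_fin, nsmul_eq_mul] at h1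
  simp only [NNReal.coe_natCast]
  linarith

theorem Assumptions.measurable_err (h : p.Assumptions D G) (hm : 1 ≤ m) (hW : p.W.Nonempty) :
    Measurable fun x : E × (Fin m → ℝ) => p.err x.1 x.2 := by
  unfold err
  refine Measurable.sub ?_ ((h.continuous_sInf_phi hW).measurable.comp measurable_snd)
  simp only [p.sSup_phi_eq hm]
  have : Measurable fun w => Finset.univ.sup' (univ_fin_nonempty hm)
      fun i => p.risk i w := by
    have := Finset.measurable_sup' (univ_fin_nonempty hm) (f := fun i => p.risk i)
      fun i _ => h.measurable_risk i
    convert this using 1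
    funext w
    rw [Finset.sup'_apply]
  exact this.comp measurable_fst

end Error

/-- The comparison iterates for the noise in `w`. -/
def ghostW (p : Problem E Z m) (η : ℝ) (z : ℕ → Fin m → Z) (w : ℕ → E) (q : ℕ → Fin m → ℝ) :
    ℕ → E
  | 0 => w 0
  | t + 1 => mirrorStep p.W p.ν (ghostW p η z w q t) (η • p.noiseW (w t) (q t) (z t))

/-- The comparison iterates for the noise in `q`. -/
def ghostQ (p : Problem E Z m) (η : ℝ) (z : ℕ → Fin m → Z) (w : ℕ → E) (q : ℕ → Fin m → ℝ) :
    ℕ → Fin m → ℝ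
  | 0 => q 0
  | t + 1 => hedgeStep (ghostQ p η z w q t) (fun i => η * p.noiseQ (w t) (z t) i)

namespace IsRun

variable {p : Problem E Z m} {ηw ηq : ℝ} {T : ℕ} {z : ℕ → Fin m → Z} {w : ℕ → E}
  {q : ℕ → Fin m → ℝ}

theorem isArgmin_mirrorObjective (hr : p.IsRun ηw ηq T z w q) {t : ℕ} (ht : t < T) :
    IsArgmin (mirrorObjective p.W p.ν (w t) (ηw • p.stochGradW (w t) (q t) (z t))) p.W
      (w (t + 1)) := hr.step_w t ht

theorem w_mem_proxDomain (hr : p.IsRun ηw ηq T z w q) {t : ℕ} (ht : t ≤ T) :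
    w t ∈ proxDomain p.W p.ν := by
  cases t with
  | zero => exact mem_proxDomain_of_isArgmin hr.init_w
  | succ t => exact mem_proxDomain_of_mirrorObjective (hr.isArgmin_mirrorObjective ht)

theorem w_mem (hr : p.IsRun ηw ηq T z w q) {t : ℕ} (ht : t ≤ T) : w t ∈ p.W :=
  (hr.w_mem_proxDomain ht).choose_spec.1

theorem q_zero_mem (hr : p.IsRun ηw ηq T z w q) (hm : 1 ≤ m) : q 0 ∈ posSimplex m := by
  have hm' : (0 : ℝ) < m := by exact_mod_cast hm
  refine ⟨fun i => by rw [hr.init_q]; positivity, ?_⟩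
  simp only [hr.init_q, Finset.sum_const, Finset.card_univ, Fintype.card_fin, nsmul_eq_mul]
  field_simp

theorem q_mem (hr : p.IsRun ηw ηq T z w q) (hm : 1 ≤ m) {t : ℕ} (ht : t ≤ T) :
    q t ∈ posSimplex m := by
  induction t with
  | zero => exact hr.q_zero_mem hm
  | succ t ih =>
    rw [eq_hedgeStep_of_isArgmin (ih (Nat.le_of_succ_le ht)) (hr.step_q t ht)]
    exact hedgeStep_mem (ih (Nat.le_of_succ_le ht)) _

theorem q_succ (hr : p.IsRun ηw ηq T z w q) (hm : 1 ≤ m) {t : ℕ} (ht : t < T) :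
    q (t + 1) = hedgeStep (q t) (fun i => ηq * p.stochGradQ (w t) (z t) i) :=
  eq_hedgeStep_of_isArgmin (hr.q_mem hm ht.le) (hr.step_q t ht)

theorem ghostQ_mem (hr : p.IsRun ηw ηq T z w q) (hm : 1 ≤ m) (t : ℕ) :
    p.ghostQ ηq z w q t ∈ posSimplex m := by
  induction t with
  | zero => exact hr.q_zero_mem hm
  | succ t ih => exact hedgeStep_mem ih _

variable [FiniteDimensional ℝ E] [MeasurableSpace E] {D G : ℝ}

theorem isCompact (hr : p.IsRun ηw ηq T z w q) (h : p.Assumptions D G) : IsCompact p.W :=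
  isCompact_of_argmin h.isClosed h.distanceGenerating.strongConvexOn h.diameter hr.init_w

theorem ghostW_mem_proxDomain (hr : p.IsRun ηw ηq T z w q) (h : p.Assumptions D G) (t : ℕ) :
    p.ghostW ηw z w q t ∈ proxDomain p.W p.ν := by
  induction t with
  | zero => exact mem_proxDomain_of_isArgmin hr.init_w
  | succ t ih =>
    exact mem_proxDomain_of_mirrorObjective
      (isArgmin_mirrorStep (hr.isCompact h) h.distanceGenerating ih.choose_spec.1 _)

theorem ghostW_mem (hr : p.IsRun ηw ηq T z w q) (h : p.Assumptions D G) (t : ℕ) :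
    p.ghostW ηw z w q t ∈ p.W := (hr.ghostW_mem_proxDomain h t).choose_spec.1

theorem isArgmin_ghostW (hr : p.IsRun ηw ηq T z w q) (h : p.Assumptions D G) (t : ℕ) :
    IsArgmin (mirrorObjective p.W p.ν (p.ghostW ηw z w q t)
      (ηw • p.noiseW (w t) (q t) (z t))) p.W (p.ghostW ηw z w q (t + 1)) :=
  isArgmin_mirrorStep (hr.isCompact h) h.distanceGenerating (hr.ghostW_mem h t) _

end IsRun

/-- The iterates of a run together with the comparison iterates. -/
def state (p : Problem E Z m) (ηw ηq : ℝ) (z : ℕ → Fin m → Z) (w : ℕ → E) (q : ℕ → Fin m → ℝ)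
    (t : ℕ) : E × (Fin m → ℝ) × E × (Fin m → ℝ) :=
  (w t, q t, p.ghostW ηw z w q t, p.ghostQ ηq z w q t)

variable [FiniteDimensional ℝ E] [MeasurableSpace E] {D G : ℝ}

/-- The gap of a round in terms of the linearized regrets and of the noise. -/
theorem Assumptions.gap_le {p : Problem E Z m} (h : p.Assumptions D G) {w u v : E} (hw : w ∈ p.W)
    (hu : u ∈ p.W) {q : Fin m → ℝ} (hq : q ∈ stdSimplex ℝ (Fin m)) (r s : Fin m → ℝ)
    (z : Fin m → Z) :
    p.phi w r - p.phi u q ≤ p.stochGradW w q z (w - u) + ∑ i, p.stochGradQ w z i * (r i - q i)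
      + p.noiseW w q z (v - u) + ∑ i, p.noiseQ w z i * (r i - s i) + p.noise (w, q, v, s) z := by
  have h1 : ∑ i, q i * (p.risk i w - p.risk i u) ≤
      p.stochGradW w q z (w - u) + p.noiseW w q z (w - u) := by
    simp only [stochGradW, noiseW, sum_apply, smul_apply, sub_apply, smul_eq_mul]
    rw [← Finset.sum_add_distrib]
    refine Finset.sum_le_sum fun i _ => ?_
    have := mul_le_mul_of_nonneg_left (h.risk_sub_le i hw hu) (hq.1 i)
    linarith
  have h2 : p.phi w r - p.phi u q = ∑ i, q i * (p.risk i w - p.risk i u)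
      + ∑ i, (p.stochGradQ w z i * (r i - q i) + p.noiseQ w z i * (r i - s i)
        + p.noiseQ w z i * (s i - q i)) := by
    simp only [phi, stochGradQ, noiseQ]
    rw [← Finset.sum_add_distrib, ← Finset.sum_sub_distrib]
    exact Finset.sum_congr rfl fun i _ => by ring
  have h3 : p.noiseW w q z (w - u) = p.noiseW w q z (v - u) + p.noiseW w q z (w - v) := by
    rw [← map_add]; congr 1; abel
  rw [h2, Finset.sum_add_distrib, Finset.sum_add_distrib, noise]
  simp only
  linarith

/-- The error of the averaged iterates, up to the noise. -/
theorem IsRun.err_le {p : Problem E Z m} (h : p.Assumptions D G) {T : ℕ} (hm : 1 ≤ m)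
    (hT : 1 ≤ T) {z : ℕ → Fin m → Z} {w : ℕ → E} {q : ℕ → Fin m → ℝ}
    (hr : p.IsRun (stepW D G m T) (stepQ D G m T) T z w q)
    (hz : ∀ t < T, ∀ i, p.IsGoodSample G (z t i)) :
    p.err (average T w) (average T q) ≤ 2 * √(10 * (D ^ 2 * G ^ 2 + Real.log m) / T)
      + 1 / T * ∑ t ∈ Finset.range T,
        p.noise (p.state (stepW D G m T) (stepQ D G m T) z w q t) (z t) := by
  have hT' : (0 : ℝ) < T := by positivity
  have hlog : 0 ≤ Real.log m := Real.log_natCast_nonneg m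
  set L := D ^ 2 * G ^ 2 + Real.log m with hL
  have hL0 : 0 ≤ L := by positivity
  set c := √(8 / (5 * T * L)) with hc
  have hc0 : 0 ≤ c := Real.sqrt_nonneg _
  have hcL : 0 < L → 0 < c := fun hL => by rw [hc]; positivity
  have hDG : D ^ 2 * G ^ 2 ≠ 0 → 0 < c := fun hne =>
    hcL (add_pos_of_pos_of_nonneg (lt_of_le_of_ne (by positivity) hne.symm) hlog)
  have hlogc : Real.log m ≠ 0 → 0 < c := fun hne =>
    hcL (add_pos_of_nonneg_of_pos (by positivity) (lt_of_le_of_ne hlog hne.symm))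
  have hW : stepW D G m T = D ^ 2 * c := rfl
  have hQ : stepQ D G m T = Real.log m * c := rfl
  rw [hW, hQ] at hr ⊢
  set v := p.ghostW (D ^ 2 * c) z w q
  set s := p.ghostQ (Real.log m * c) z w q
  have hw : ∀ t < T, w t ∈ p.W := fun t ht => hr.w_mem ht.le
  have hq : ∀ t < T, q t ∈ stdSimplex ℝ (Fin m) := fun t ht =>
    posSimplex_subset (hr.q_mem hm ht.le)
  refine err_le_of_forall hm ⟨_, hr.init_w.1⟩ fun r hrm u hu => ?_
  have hW1 := mirror_regret_scaled h.distanceGenerating h.diameter hc0 hDG hr.init_w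
    (fun t ht => hr.isArgmin_mirrorObjective ht)
    (fun t ht => norm_stochGradW_le (hw t ht) (hq t ht) (hz t ht)) hu
  have hW2 := mirror_regret_scaled h.distanceGenerating h.diameter hc0 (K := 2 * G)
    (w := v) (T := T) (fun hne => hDG fun h0 => hne (by rw [mul_pow, mul_left_comm, h0, mul_zero]))
    hr.init_w (fun t _ => hr.isArgmin_ghostW h t)
    (fun t ht => h.norm_noiseW_le (hw t ht) (hq t ht) (hz t ht)) hu
  have hQ1 := hedge_regret_scaled hm hc0 hlogc hr.init_q (fun t ht => hr.q_succ hm ht)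
    (fun t ht => hr.q_mem hm ht.le) (a := 0) (K := 1) zero_le_one
    (fun t ht i => by simpa [stochGradQ] using (hz t ht i).loss_mem _ (hw t ht)) hrm
  have hQ2 := hedge_regret_scaled (T := T) hm hc0 hlogc (q := s) hr.init_q (fun _ _ => rfl)
    (fun t ht => hr.ghostQ_mem hm t) (a := -1) (K := 2) zero_le_two
    (fun t ht i => by
      have := abs_le.1 (h.abs_noiseQ_le (hw t ht) (hz t ht) i)
      constructor <;> linarith [this.1, this.2]) hrm
  have hsum : ∑ t ∈ Finset.range T, (p.phi (w t) r - p.phi u (q t)) ≤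
      T * (2 * √(10 * L / T)) + ∑ t ∈ Finset.range T,
        p.noise (p.state (D ^ 2 * c) (Real.log m * c) z w q t) (z t) := by
    have h1 := Finset.sum_le_sum fun t ht => h.gap_le (v := v t) (hw t (Finset.mem_range.1 ht)) hu
      (hq t (Finset.mem_range.1 ht)) r (s t) (z t)
    simp only [Finset.sum_add_distrib] at h1
    have h2 := step_constant_bound hL0 hT hc
    refine h1.trans (add_le_add_left ?_ _)
    refine le_trans ?_ h2
    -- The gradient bounds enter squared: the sampled gradients contribute with factor 1 and the
    -- noise with factor 4, hence 5/2 = (1 + 4)/2.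
    have e : 4 * (1 / c) + T * (5 / 2 * c * L) =
        (1 / c + T * (1 / 2 * (c * (D ^ 2 * G ^ 2))))
        + (1 / c + T * (1 / 2 * (c * (Real.log m * 1 ^ 2))))
        + (1 / c + T * (1 / 2 * (c * (D ^ 2 * (2 * G) ^ 2))))
        + (1 / c + T * (1 / 2 * (c * (Real.log m * 2 ^ 2)))) := by rw [hL]; ring
    rw [e]
    exact add_le_add (add_le_add (add_le_add hW1 hQ1) hW2) hQ2
  have hJ : p.phi (average T w) r - p.phi u (average T q) ≤
      1 / T * ∑ t ∈ Finset.range T, (p.phi (w t) r - p.phi u (q t)) := by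
    have hphi : ConvexOn ℝ p.W fun w => p.phi w r := by
      have : (fun w => p.phi w r) = ∑ i, r i • p.risk i := by
        funext w; simp [phi]
      rw [this]
      exact Finset.sum_induction _ (ConvexOn ℝ p.W) (fun _ _ h1 h2 => h1.add h2)
        (convexOn_const 0 h.convex) fun i _ => (h.convexOn_risk i).smul (hrm.1 i)
    have h1 := ConvexOn.map_average_le hphi hT hw
    rw [phi_average, Finset.sum_sub_distrib, mul_sub]
    simp only [average, smul_eq_mul] at h1 ⊢
    linarith
  refine hJ.trans ((mul_le_mul_of_nonneg_left hsum (by positivity)).trans (le_of_eq ?_))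
  rw [mul_add]
  field_simp

end Problem

/-! ### Integration over a sample independent of the past. -/

section IndependentStep

variable {Ω S Y : Type*} [MeasurableSpace Ω] [MeasurableSpace S] [MeasurableSpace Y]
  {μ : Measure Ω} [IsProbabilityMeasure μ] {X : Ω → S} {Z : Ω → Y} {ρ : Measure Y}

theorem map_prodMk_eq (hX : Measurable X) (hZ : Measurable Z) (hind : IndepFun X Z μ)
    (hρ : μ.map Z = ρ) : μ.map (fun ω => (X ω, Z ω)) = (μ.map X).prod ρ := by
  rw [← hρ]
  exact (indepFun_iff_map_prod_eq_prod_map_map hX.aemeasurable hZ.aemeasurable).1 hind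

/-- Fubini replaces conditional expectation: X is frozen while Z is integrated out. This is the
inductive step for the exponential moments. -/
theorem lintegral_mul_le_of_indep [SFinite ρ] (hX : Measurable X) (hZ : Measurable Z)
    (hind : IndepFun X Z μ) (hρ : μ.map Z = ρ) {f : S → ENNReal} {g : S × Y → ENNReal}
    (hf : Measurable f) (hg : Measurable g) {K : ENNReal}
    (hK : ∀ ω, ∫⁻ y, g (X ω, y) ∂ρ ≤ K) :
    ∫⁻ ω, f (X ω) * g (X ω, Z ω) ∂μ ≤ (∫⁻ ω, f (X ω) ∂μ) * K := by
  have hm : Measurable fun x : S × Y => f x.1 * g x := (hf.comp measurable_fst).mul hg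
  calc ∫⁻ ω, f (X ω) * g (X ω, Z ω) ∂μ
      = ∫⁻ x, f x.1 * g x ∂(μ.map fun ω => (X ω, Z ω)) :=
        (lintegral_map hm (hX.prodMk hZ)).symm
    _ = ∫⁻ x, ∫⁻ y, f x * g (x, y) ∂ρ ∂(μ.map X) := by
        rw [map_prodMk_eq hX hZ hind hρ, lintegral_prod _ hm.aemeasurable]
    _ = ∫⁻ x, f x * ∫⁻ y, g (x, y) ∂ρ ∂(μ.map X) := by
        refine lintegral_congr fun x => ?_
        exact lintegral_const_mul _ (hg.comp measurable_prodMk_left)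
    _ = ∫⁻ ω, f (X ω) * ∫⁻ y, g (X ω, y) ∂ρ ∂μ :=
        lintegral_map (hf.mul hg.lintegral_prod_right') hX
    _ ≤ ∫⁻ ω, f (X ω) * K ∂μ := lintegral_mono fun ω => mul_le_mul_right (hK ω) _
    _ = _ := lintegral_mul_const _ (hf.comp hX)

theorem integral_eq_zero_of_indep [SFinite ρ] (hX : Measurable X) (hZ : Measurable Z)
    (hind : IndepFun X Z μ) (hρ : μ.map Z = ρ) {g : S × Y → ℝ} (hg : Measurable g)
    (hint : Integrable (fun ω => g (X ω, Z ω)) μ) (h0 : ∀ ω, ∫ y, g (X ω, y) ∂ρ = 0) :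
    ∫ ω, g (X ω, Z ω) ∂μ = 0 := by
  have hXZ := hX.prodMk hZ
  have hint' : Integrable g ((μ.map X).prod ρ) := by
    rw [← map_prodMk_eq hX hZ hind hρ]
    exact (integrable_map_measure hg.aestronglyMeasurable hXZ.aemeasurable).2 hint
  have := Measure.isProbabilityMeasure_map (μ := μ) hX.aemeasurable
  calc ∫ ω, g (X ω, Z ω) ∂μ = ∫ x, g x ∂(μ.map fun ω => (X ω, Z ω)) :=
        (integral_map hXZ.aemeasurable hg.aestronglyMeasurable).symm
    _ = ∫ x, ∫ y, g (x, y) ∂ρ ∂(μ.map X) := by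
        rw [map_prodMk_eq hX hZ hind hρ, integral_prod _ hint']
    _ = ∫ ω, ∫ y, g (X ω, y) ∂ρ ∂μ :=
        integral_map hX.aemeasurable hg.stronglyMeasurable.integral_prod_right'.aestronglyMeasurable
    _ = 0 := by simp [h0]

/-- Hoeffding's lemma in terms of the Lebesgue integral. -/
theorem lintegral_exp_le_of_abs_le [IsProbabilityMeasure ρ] {f : Y → ℝ} (hf : Measurable f)
    {b : ℝ} (hb : ∀ᵐ y ∂ρ, |f y| ≤ b) (h0 : ∫ y, f y ∂ρ = 0) (s : ℝ) :
    ∫⁻ y, ENNReal.ofReal (Real.exp (s * f y)) ∂ρ ≤ ENNReal.ofReal (Real.exp (b ^ 2 * s ^ 2 / 2)) := by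
  have h := hasSubgaussianMGF_of_mem_Icc_of_integral_eq_zero (a := -b) (b := b) hf.aemeasurable
    (by filter_upwards [hb] with y hy using abs_le.1 hy) h0
  rw [← ofReal_integral_eq_lintegral_ofReal (h.integrable_exp_mul s)
    (Eventually.of_forall fun _ => (Real.exp_pos _).le)]
  refine ENNReal.ofReal_le_ofReal ((h.mgf_le s).trans (le_of_eq ?_))
  have e : ((‖b - -b‖₊ / 2 : NNReal) : ℝ) ^ 2 = b ^ 2 := by
    push_cast
    rw [Real.norm_eq_abs, div_pow, sq_abs]
    ring
  rw [NNReal.coe_pow, e]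

end IndependentStep

/-! ### Randomized executions: adaptedness, expectation and tail of the error. -/

namespace Execution

variable {E : Type uE} {Z : Type uZ} {Ω : Type uO} [NormedAddCommGroup E] [NormedSpace ℝ E]
  [MeasurableSpace E] [MeasurableSpace Z] [MeasurableSpace Ω] {D G : ℝ} {m T : ℕ}
  (x : Execution E Z Ω D G m T)

/-- The samples of a round. -/
def samples (t : ℕ) (ω : Ω) : Fin m → Z := fun i => x.z t i ω

/-- The iterates and comparison iterates at the start of a round. -/
def state (t : ℕ) (ω : Ω) : E × (Fin m → ℝ) × E × (Fin m → ℝ) :=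
  x.p.state (stepW D G m T) (stepQ D G m T) (fun t i => x.z t i ω) (fun t => x.w t ω)
    (fun t => x.q t ω) t

/-- The noise accumulated before a round. -/
def noiseSum (t : ℕ) (ω : Ω) : ℝ :=
  ∑ s ∈ Finset.range t, x.p.noise (x.state s ω) (x.samples s ω)

/-- The σ-algebra generated by the samples before round `t`. -/
abbrev past (t : ℕ) : MeasurableSpace Ω :=
  ⨆ k ∈ {k : Fin T × Fin m | (k.1 : ℕ) < t}, MeasurableSpace.comap (x.z k.1 k.2) inferInstance

theorem past_le (t : ℕ) : x.past t ≤ ‹MeasurableSpace Ω› :=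
  iSup₂_le fun k _ => (x.sampling.measurable k.1 k.1.2 k.2).comap_le

theorem past_mono {s t : ℕ} (hst : s ≤ t) : x.past s ≤ x.past t :=
  biSup_mono fun _ hk => lt_of_lt_of_le hk hst

theorem measurable_samples_past {t : ℕ} (ht : t < T) : Measurable[x.past (t + 1)] (x.samples t) := by
  refine @measurable_pi_lambda _ _ _ (x.past (t + 1)) _ _ fun i => ?_
  refine measurable_iff_comap_le.2 ?_
  exact le_iSup₂_of_le (f := fun (k : Fin T × Fin m) (_ : k ∈ {k : Fin T × Fin m | (k.1 : ℕ) < t + 1})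
    => MeasurableSpace.comap (x.z k.1 k.2) inferInstance) (⟨t, ht⟩, i) (Nat.lt_succ_self t) le_rfl

theorem measurable_samples {t : ℕ} (ht : t < T) : Measurable (x.samples t) :=
  (x.measurable_samples_past ht).mono (x.past_le _) le_rfl

theorem map_samples {t : ℕ} (ht : t < T) : x.μ.map (x.samples t) = Measure.pi x.p.P := by
  have := x.isProbabilityMeasure
  have hind : iIndepFun (fun i => x.z t i) x.μ :=
    x.sampling.indep.precomp (g := fun i : Fin m => ((⟨t, ht⟩ : Fin T), i))
      fun i j hij => (Prod.mk.inj hij).2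
  have h := (iIndepFun_iff_map_fun_eq_pi_map
    fun i => (x.sampling.measurable t ht i).aemeasurable).1 hind
  simp only [x.sampling.law t ht] at h
  exact h

/-- The past and the current round are generated by disjoint blocks of an independent family. -/
theorem indepFun_samples {S : Type*} [MeasurableSpace S] {t : ℕ} (ht : t < T) {X : Ω → S}
    (hX : Measurable[x.past t] X) : IndepFun X (x.samples t) x.μ := by
  have h := indep_iSup_of_disjoint
    (fun k : Fin T × Fin m => (x.sampling.measurable k.1 k.1.2 k.2).comap_le)
    ((iIndepFun_iff_iIndep _ _ _).1 x.sampling.indep)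
    (S := {k | (k.1 : ℕ) < t}) (T := {k | (k.1 : ℕ) = t})
    (Set.disjoint_left.2 fun k hk hk' => (ne_of_lt hk) hk')
  rw [IndepFun_iff_Indep]
  refine indep_of_indep_of_le_left (indep_of_indep_of_le_right h ?_) hX.comap_le
  refine Measurable.comap_le (@measurable_pi_lambda _ _ _ (_) _ _ fun i => ?_)
  refine measurable_iff_comap_le.2 ?_
  exact le_iSup₂_of_le (f := fun (k : Fin T × Fin m) (_ : k ∈ {k : Fin T × Fin m | (k.1 : ℕ) = t})
    => MeasurableSpace.comap (x.z k.1 k.2) inferInstance) (⟨t, ht⟩, i) rfl le_rfl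

theorem ae_isGoodSample : ∀ᵐ ω ∂x.μ, ∀ t < T, ∀ i, x.p.IsGoodSample G (x.z t i ω) := by
  rw [ae_all_iff]
  intro t
  by_cases ht : t < T
  · have : ∀ i, ∀ᵐ ω ∂x.μ, x.p.IsGoodSample G (x.z t i ω) := fun i => by
      have h := x.assumptions.ae_good i
      rw [← x.sampling.law t ht i] at h
      exact ae_of_ae_map (x.sampling.measurable t ht i).aemeasurable h
    filter_upwards [ae_all_iff.2 this] with ω hω _ using hω
  · exact Eventually.of_forall fun _ h => absurd h ht

theorem ae_pi_isGoodSample : ∀ᵐ z ∂(Measure.pi x.p.P), ∀ i, x.p.IsGoodSample G (z i) := by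
  have := x.assumptions.isProbabilityMeasure
  exact ae_all_iff.2 fun i =>
    (measurePreserving_eval x.p.P i).quasiMeasurePreserving.ae (x.assumptions.ae_good i)

section Measurability

variable [FiniteDimensional ℝ E]

theorem abs_noise_le (hm : 1 ≤ m) {t : ℕ} (ht : t ≤ T) (ω : Ω) {z : Fin m → Z}
    (hz : ∀ i, x.p.IsGoodSample G (z i)) :
    |x.p.noise (x.state t ω) z| ≤ 2 * √(10 * (D ^ 2 * G ^ 2 + Real.log m)) :=
  x.assumptions.abs_noise_le hm (x.run ω).init_w ((x.run ω).w_mem ht)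
    (posSimplex_subset ((x.run ω).q_mem hm ht)) ((x.run ω).ghostW_mem x.assumptions t)
    (posSimplex_subset ((x.run ω).ghostQ_mem hm t)) hz

theorem ae_error_le (hm : 1 ≤ m) (hT : 1 ≤ T) : ∀ᵐ ω ∂x.μ, x.error ω ≤
    2 * √(10 * (D ^ 2 * G ^ 2 + Real.log m) / T) + 1 / T * x.noiseSum T ω := by
  filter_upwards [x.ae_isGoodSample] with ω hω
  exact (x.run ω).err_le x.assumptions hm hT hω

variable [BorelSpace E]

/-- Adaptedness of iterates and comparison iterates. The initial state is constant, by uniqueness of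
the minimizer of ν; each later component is a measurable function of the previous state and the new
samples. -/
theorem measurable_state (hm : 1 ≤ m) {t : ℕ} (ht : t ≤ T) :
    Measurable[x.past t] (x.state t) := by
  have := x.isProbabilityMeasure
  have := FiniteDimensional.proper ℝ (E →L[ℝ] ℝ)
  -- Compactness of W needs a minimizer of ν, which the run at any single outcome provides.
  obtain ⟨ω₀⟩ := x.μ.nonempty_of_neZero
  have hcomp := (x.run ω₀).isCompact x.assumptions
  have hν := x.assumptions.distanceGenerating
  induction t with
  | zero =>
    have hw : ∀ ω ω', x.w 0 ω = x.w 0 ω' := fun ω ω' =>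
      isArgmin_unique_of_linear_add hν.strongConvexOn (p := 0) (k := 0) (by simp)
        (x.run ω).init_w (x.run ω').init_w
    have hq : ∀ ω ω', x.q 0 ω = x.q 0 ω' := fun ω ω' => by
      funext i
      exact ((x.run ω).init_q i).trans ((x.run ω').init_q i).symm
    refine @measurable_const' _ _ _ (x.past 0) _ fun ω ω' => ?_
    simp only [state, Problem.state, Problem.ghostW, Problem.ghostQ]
    rw [hw ω ω', hq ω ω']
  | succ t ih =>
    have ht' : t < T := ht
    have hX : Measurable[x.past (t + 1)] (x.state t) :=
      (ih ht'.le).mono (x.past_mono t.le_succ) le_rfl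
    have hZ := x.measurable_samples_past ht'
    have hw : Measurable[x.past (t + 1)] fun ω => x.w t ω := measurable_fst.comp hX
    have hX2 : Measurable[x.past (t + 1)] fun ω => (x.state t ω).2 := measurable_snd.comp hX
    have hq : Measurable[x.past (t + 1)] fun ω => x.q t ω := measurable_fst.comp hX2
    have hX3 : Measurable[x.past (t + 1)] fun ω => (x.state t ω).2.2 := measurable_snd.comp hX2
    have hv := measurable_fst.comp hX3
    have hr := measurable_snd.comp hX3
    refine Measurable.prodMk ?_ (Measurable.prodMk ?_ (Measurable.prodMk ?_ ?_))
    · refine measurable_mirror_step hcomp hν hw (fun ω => (x.run ω).w_mem_proxDomain ht'.le)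
        ?_ fun ω => (x.run ω).isArgmin_mirrorObjective ht'
      have hg : Measurable[x.past (t + 1)] fun ω =>
          x.p.stochGradW (x.w t ω) (x.q t ω) (x.samples t ω) :=
        x.assumptions.measurable_stochGradW.comp (hw.prodMk (hq.prodMk hZ))
      exact hg.const_smul (stepW D G m T)
    · have h := measurable_hedgeStep.comp (hq.prodMk
        ((x.assumptions.measurable_stochGradQ.comp (hw.prodMk hZ)).const_smul (stepQ D G m T)))
      convert h using 1
      funext ω
      exact (x.run ω).q_succ hm ht'
    · refine measurable_mirror_step hcomp hν hv
        (fun ω => (x.run ω).ghostW_mem_proxDomain x.assumptions t)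
        ?_ fun ω => (x.run ω).isArgmin_ghostW x.assumptions t
      have hg : Measurable[x.past (t + 1)] fun ω =>
          x.p.noiseW (x.w t ω) (x.q t ω) (x.samples t ω) :=
        x.assumptions.measurable_noiseW.comp (hw.prodMk (hq.prodMk hZ))
      exact hg.const_smul (stepW D G m T)
    · exact measurable_hedgeStep.comp (hr.prodMk
        ((x.assumptions.measurable_noiseQ.comp (hw.prodMk hZ)).const_smul (stepQ D G m T)))

theorem measurable_noiseSum (hm : 1 ≤ m) {t : ℕ} (ht : t ≤ T) :
    Measurable[x.past t] (x.noiseSum t) := by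
  have h : ∀ s ∈ Finset.range t,
      Measurable[x.past t] fun ω => x.p.noise (x.state s ω) (x.samples s ω) := fun s hs => by
    have hst := Finset.mem_range.1 hs
    have hsT := hst.trans_le ht
    have h1 : Measurable[x.past t] (x.state s) :=
      (x.measurable_state hm hsT.le).mono (x.past_mono hst.le) le_rfl
    have h2 : Measurable[x.past t] (x.samples s) :=
      (x.measurable_samples_past hsT).mono (x.past_mono hst) le_rfl
    have h3 : Measurable[x.past t] fun ω => (x.state s ω, x.samples s ω) := h1.prodMk h2
    have h4 := x.assumptions.measurable_noise
    generalize x.p.noise = f at h4 ⊢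
    exact h4.comp h3
  exact Finset.measurable_sum _ h

theorem measurable_error (hm : 1 ≤ m) : Measurable x.error := by
  have := x.isProbabilityMeasure
  have := FiniteDimensional.proper ℝ E
  obtain ⟨ω₀⟩ := x.μ.nonempty_of_neZero
  have hst : ∀ t < T, Measurable (x.state t) := fun t ht =>
    (x.measurable_state hm ht.le).mono (x.past_le t) le_rfl
  have hw : Measurable fun ω => average T fun t => x.w t ω := by
    have h : Measurable fun ω => ∑ t ∈ Finset.range T, x.w t ω :=
      Finset.measurable_sum _ fun t ht => measurable_fst.comp (hst t (Finset.mem_range.1 ht))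
    exact h.const_smul (1 / (T : ℝ))
  have hq : Measurable fun ω => average T fun t => x.q t ω := by
    have h : Measurable fun ω => ∑ t ∈ Finset.range T, x.q t ω := Finset.measurable_sum _
      fun t ht => (measurable_fst.comp measurable_snd).comp (hst t (Finset.mem_range.1 ht))
    exact h.const_smul (1 / (T : ℝ))
  have h := x.assumptions.measurable_err hm ⟨_, (x.run ω₀).init_w.1⟩
  unfold error
  generalize x.p.err = f at h ⊢
  exact h.comp (hw.prodMk hq)

theorem integrable_error (hm : 1 ≤ m) (hT : 1 ≤ T) : Integrable x.error x.μ := by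
  have := x.isProbabilityMeasure
  refine Integrable.of_bound (x.measurable_error hm).aestronglyMeasurable 1
    (Eventually.of_forall fun ω => ?_)
  exact x.assumptions.abs_err_le_one
    (average_mem x.assumptions.convex hT fun t ht => (x.run ω).w_mem ht.le)
    (average_mem (convex_stdSimplex ℝ _) hT fun t ht =>
      posSimplex_subset ((x.run ω).q_mem hm ht.le))

theorem integrable_noise (hm : 1 ≤ m) {t : ℕ} (ht : t < T) :
    Integrable (fun ω => x.p.noise (x.state t ω) (x.samples t ω)) x.μ := by
  have := x.isProbabilityMeasure
  refine Integrable.of_bound (x.assumptions.measurable_noise.comp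
    (((x.measurable_state hm ht.le).mono (x.past_le t) le_rfl).prodMk
      (x.measurable_samples ht))).aestronglyMeasurable
    (2 * √(10 * (D ^ 2 * G ^ 2 + Real.log m))) ?_
  filter_upwards [x.ae_isGoodSample] with ω hω
  exact x.abs_noise_le hm ht.le ω (hω t ht)

theorem integral_noise (hm : 1 ≤ m) {t : ℕ} (ht : t < T) :
    ∫ ω, x.p.noise (x.state t ω) (x.samples t ω) ∂x.μ = 0 := by
  have := x.isProbabilityMeasure
  have := x.assumptions.isProbabilityMeasure
  exact integral_eq_zero_of_indep ((x.measurable_state hm ht.le).mono (x.past_le t) le_rfl)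
    (x.measurable_samples ht) (x.indepFun_samples ht (x.measurable_state hm ht.le))
    (x.map_samples ht) x.assumptions.measurable_noise (x.integrable_noise hm ht)
    fun ω => x.assumptions.integral_noise ((x.run ω).w_mem ht.le)

theorem integrable_noiseSum (hm : 1 ≤ m) : Integrable (x.noiseSum T) x.μ :=
  integrable_finsetSum _ fun _ ht => x.integrable_noise hm (Finset.mem_range.1 ht)

theorem integral_noiseSum (hm : 1 ≤ m) : ∫ ω, x.noiseSum T ω ∂x.μ = 0 := by
  refine (integral_finsetSum _ fun t ht => x.integrable_noise hm (Finset.mem_range.1 ht)).trans ?_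
  exact Finset.sum_eq_zero fun t ht => x.integral_noise hm (Finset.mem_range.1 ht)

theorem integral_error_le (hm : 1 ≤ m) (hT : 1 ≤ T) :
    ∫ ω, x.error ω ∂x.μ ≤ 2 * √(10 * (D ^ 2 * G ^ 2 + Real.log m) / T) := by
  have := x.isProbabilityMeasure
  have h := integral_mono_ae (x.integrable_error hm hT)
    ((integrable_const (2 * √(10 * (D ^ 2 * G ^ 2 + Real.log m) / T))).add
      ((x.integrable_noiseSum hm).const_mul (1 / (T : ℝ)))) (x.ae_error_le hm hT)
  refine h.trans (le_of_eq ?_)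
  refine (integral_add (integrable_const _) ((x.integrable_noiseSum hm).const_mul _)).trans ?_
  rw [integral_const_mul (1 / (T : ℝ)), x.integral_noiseSum hm]
  simp

/-- The exponential moments of the accumulated noise. -/
theorem lintegral_exp_noiseSum_le (hm : 1 ≤ m) (s : ℝ) {t : ℕ} (ht : t ≤ T) :
    ∫⁻ ω, ENNReal.ofReal (Real.exp (s * x.noiseSum t ω)) ∂x.μ ≤ ENNReal.ofReal
      (Real.exp (t * ((2 * √(10 * (D ^ 2 * G ^ 2 + Real.log m))) ^ 2 * s ^ 2 / 2))) := by
  have := x.isProbabilityMeasure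
  have := x.assumptions.isProbabilityMeasure
  set b := 2 * √(10 * (D ^ 2 * G ^ 2 + Real.log m))
  induction t with
  | zero => simp [noiseSum]
  | succ t ih =>
    have ht' : t < T := ht
    have hX : Measurable[x.past t] fun ω => (x.noiseSum t ω, x.state t ω) :=
      (x.measurable_noiseSum hm ht'.le).prodMk (x.measurable_state hm ht'.le)
    have hnoise := x.assumptions.measurable_noise
    -- The last increment is peeled off: the exponential of the earlier noise depends on the past,
    -- and Hoeffding's lemma bounds the remaining factor for every frozen state.
    have hstep := lintegral_mul_le_of_indep (hX.mono (x.past_le t) le_rfl)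
      (x.measurable_samples ht') (x.indepFun_samples ht' hX) (x.map_samples ht')
      (f := fun y => ENNReal.ofReal (Real.exp (s * y.1)))
      (g := fun y => ENNReal.ofReal (Real.exp (s * x.p.noise y.1.2 y.2)))
      (K := ENNReal.ofReal (Real.exp (b ^ 2 * s ^ 2 / 2)))
      (by fun_prop)
      (((hnoise.comp (by fun_prop : Measurable fun y : (ℝ × E × (Fin m → ℝ) × E × (Fin m → ℝ)) ×
        (Fin m → Z) => (y.1.2, y.2))).const_mul s).exp.ennreal_ofReal)
      (fun ω => lintegral_exp_le_of_abs_le (hnoise.comp measurable_prodMk_left)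
        (by filter_upwards [x.ae_pi_isGoodSample] with z hz
            exact x.abs_noise_le hm ht'.le ω hz)
        (x.assumptions.integral_noise ((x.run ω).w_mem ht'.le)) s)
    have e : ∀ ω, ENNReal.ofReal (Real.exp (s * x.noiseSum (t + 1) ω)) =
        ENNReal.ofReal (Real.exp (s * x.noiseSum t ω)) *
          ENNReal.ofReal (Real.exp (s * x.p.noise (x.state t ω) (x.samples t ω))) := fun ω => by
      rw [← ENNReal.ofReal_mul (Real.exp_pos _).le, ← Real.exp_add, ← mul_add, noiseSum, noiseSum,
        Finset.sum_range_succ]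
    simp only [e]
    refine hstep.trans ((mul_le_mul_left (ih ht'.le) _).trans (le_of_eq ?_))
    rw [← ENNReal.ofReal_mul (Real.exp_pos _).le, ← Real.exp_add]
    congr 2
    push_cast
    ring

/-- Chernoff's bound with parameter 1/(b√T), for which the exponential moment is at most e^(1/2).
The probability is thus at most e^(1/2 - 3) δ/2. The offset 3 is generous; it produces the 8 of the
final bound. -/
theorem measure_noiseSum_ge_le (hm : 1 ≤ m) (hT : 1 ≤ T)
    (hL : 0 < D ^ 2 * G ^ 2 + Real.log m) {δ : ℝ} (hδ : 0 < δ) :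
    x.μ {ω | (3 + Real.log (2 / δ)) * (2 * √(10 * (D ^ 2 * G ^ 2 + Real.log m)) * √T)
      ≤ x.noiseSum T ω} ≤ ENNReal.ofReal δ := by
  have hT' : (0 : ℝ) < T := by positivity
  set b := 2 * √(10 * (D ^ 2 * G ^ 2 + Real.log m)) with hb
  set l := Real.log (2 / δ) with hl
  have hbT : 0 < b * √T := by positivity
  have h1 := x.lintegral_exp_noiseSum_le hm (1 / (b * √T)) le_rfl
  have e1 : T * (b ^ 2 * (1 / (b * √T)) ^ 2 / 2) = 1 / 2 := by
    rw [div_pow, mul_pow b, Real.sq_sqrt hT'.le]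
    have : b ≠ 0 := by positivity
    field_simp
  rw [← hb, e1] at h1
  have hmeas : Measurable fun ω => ENNReal.ofReal (Real.exp (1 / (b * √T) * x.noiseSum T ω)) :=
    ((((x.measurable_noiseSum hm le_rfl).mono (x.past_le T) le_rfl).const_mul _).exp).ennreal_ofReal
  have h2 := (mul_meas_ge_le_lintegral (μ := x.μ) hmeas
    (ENNReal.ofReal (Real.exp (3 + l)))).trans h1
  have hsub : {ω | (3 + l) * (b * √T) ≤ x.noiseSum T ω} ⊆ {ω | ENNReal.ofReal (Real.exp (3 + l)) ≤
      ENNReal.ofReal (Real.exp (1 / (b * √T) * x.noiseSum T ω))} := fun ω hω => by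
    refine ENNReal.ofReal_le_ofReal (Real.exp_le_exp.2 ?_)
    rw [one_div, inv_mul_eq_div, le_div_iff₀ hbT]
    exact hω
  refine (measure_mono hsub).trans ?_
  have hpos : ENNReal.ofReal (Real.exp (3 + l)) ≠ 0 := by
    rw [Ne, ENNReal.ofReal_eq_zero, not_le]; exact Real.exp_pos _
  refine (ENNReal.mul_le_mul_iff_right hpos ENNReal.ofReal_ne_top).1 (h2.trans ?_)
  rw [← ENNReal.ofReal_mul (Real.exp_pos _).le]
  refine ENNReal.ofReal_le_ofReal ?_
  rw [Real.exp_add, hl, Real.exp_log (by positivity)]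
  have h3 : Real.exp (1 / 2) ≤ Real.exp 3 := Real.exp_le_exp.2 (by norm_num)
  have e2 : Real.exp 3 * (2 / δ) * δ = 2 * Real.exp 3 := by field_simp
  rw [e2]
  linarith [Real.exp_pos 3]

theorem measure_error_le (hm : 1 ≤ m) (hT : 1 ≤ T) {δ : ℝ} (hδ : 0 < δ) :
    ENNReal.ofReal (1 - δ) ≤ x.μ {ω | x.error ω ≤
      (8 + 2 * Real.log (2 / δ)) * √(10 * (D ^ 2 * G ^ 2 + Real.log m) / T)} := by
  have := x.isProbabilityMeasure
  have hT' : (0 : ℝ) < T := by positivity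
  have hL0 : 0 ≤ D ^ 2 * G ^ 2 + Real.log m := by
    have := Real.log_natCast_nonneg m
    positivity
  set A := {ω | x.error ω ≤
      (8 + 2 * Real.log (2 / δ)) * √(10 * (D ^ 2 * G ^ 2 + Real.log m) / T)} with hA
  have hAc : x.μ Aᶜ ≤ ENNReal.ofReal δ := by
    -- When L = 0 the Chernoff parameter is undefined, but the noise vanishes almost surely.
    rcases hL0.eq_or_lt with h0 | hL
    · have : x.μ Aᶜ = 0 := by
        change ∀ᵐ ω ∂x.μ, ω ∈ A
        filter_upwards [x.ae_error_le hm hT, x.ae_isGoodSample] with ω hω hg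
        have hn : x.noiseSum T ω = 0 := Finset.sum_eq_zero fun t ht => by
          have ht' := Finset.mem_range.1 ht
          have := x.abs_noise_le hm ht'.le ω (hg t ht')
          rw [← h0, mul_zero, Real.sqrt_zero, mul_zero] at this
          exact abs_nonpos_iff.1 this
        rw [hn, ← h0] at hω
        rw [hA, Set.mem_ofPred_eq, ← h0]
        simpa using hω
      rw [this]
      exact zero_le
    · refine le_trans (measure_mono_ae ?_) (x.measure_noiseSum_ge_le hm hT hL hδ)
      filter_upwards [x.ae_error_le hm hT] with ω hω hωA
      by_contra hlt
      refine hωA ?_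
      have hlt' : x.noiseSum T ω < (3 + Real.log (2 / δ)) *
          (2 * √(10 * (D ^ 2 * G ^ 2 + Real.log m)) * √T) := not_le.1 hlt
      have e : √(10 * (D ^ 2 * G ^ 2 + Real.log m) / T) =
          1 / T * (√(10 * (D ^ 2 * G ^ 2 + Real.log m)) * √T) := by
        rw [Real.sqrt_div (by positivity), div_eq_iff (by positivity)]
        rw [mul_assoc, mul_assoc, Real.mul_self_sqrt hT'.le]
        field_simp
      -- The coefficients of √(10L/T) add up as 2 + 2(3 + log(2/δ)) = 8 + 2 log(2/δ).
      refine hω.trans ?_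
      have h1 := mul_le_mul_of_nonneg_left hlt'.le (show 0 ≤ 1 / (T : ℝ) by positivity)
      rw [e]
      linarith
  rw [ENNReal.ofReal_sub _ hδ.le, ENNReal.ofReal_one, tsub_le_iff_right]
  calc (1 : ENNReal) = x.μ (A ∪ Aᶜ) := by rw [Set.union_compl_self, measure_univ]
    _ ≤ x.μ A + x.μ Aᶜ := measure_union_le _ _
    _ ≤ _ := by gcongr

end Measurability

end Execution

/-! ### The number of rounds for a prescribed error, and the theorem. -/

/-- The number of rounds that makes the high-probability bound at most `ε`. -/
theorem exists_rounds (A : ℝ) (hA : 0 ≤ A) : ∃ C : ℝ, 0 < C ∧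
    ∀ (m : ℕ) (ε δ : ℝ), 2 ≤ m → 0 < ε → ε ≤ 1 → 0 < δ → δ < 1 → ∃ T : ℕ, 1 ≤ T ∧
      (m * T : ℝ) ≤ C * Real.log (2 / δ) ^ 2 * (m * Real.log m) / ε ^ 2 ∧
      2 * √(10 * (A + Real.log m) / T) ≤ ε ∧
      (8 + 2 * Real.log (2 / δ)) * √(10 * (A + Real.log m) / T) ≤ ε := by
  set k := Real.log 2 with hk
  have hk0 : 0 < k := Real.log_pos (by norm_num)
  -- Both log(2/δ) and log m are at least k = log 2, so additive constants are absorbed: 8 + 2x ≤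
  -- (8/k + 2)x and A + l ≤ (A/k + 1)l. The summand 1/k³ pays for rounding the number of rounds up,
  -- using ε ≤ 1.
  refine ⟨10 * (8 / k + 2) ^ 2 * (A / k + 1) + 1 / k ^ 3, by positivity, ?_⟩
  intro m ε δ hm hε hε1 hδ hδ1
  have hm' : (2 : ℝ) ≤ m := by exact_mod_cast hm
  set x := Real.log (2 / δ) with hx
  set l := Real.log m with hl
  have hkx : k ≤ x := Real.log_le_log (by norm_num) (by rw [le_div_iff₀ hδ]; linarith)
  have hkl : k ≤ l := Real.log_le_log (by norm_num) hm'
  have hx0 : 0 < x := hk0.trans_le hkx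
  have hl0 : 0 < l := hk0.trans_le hkl
  -- N is the real number of rounds at which the high-probability bound equals ε.
  set N := (8 + 2 * x) ^ 2 * (10 * (A + l)) / ε ^ 2 with hN
  have hN0 : 0 < N := by positivity
  have hT0 : (0 : ℝ) < ⌈N⌉₊ := by exact_mod_cast Nat.ceil_pos.2 hN0
  have hbound : √(10 * (A + l) / ⌈N⌉₊) ≤ ε / (8 + 2 * x) := by
    rw [Real.sqrt_le_iff]
    refine ⟨by positivity, ?_⟩
    rw [div_pow, div_le_div_iff₀ hT0 (by positivity)]
    have h := Nat.le_ceil N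
    rw [hN, div_le_iff₀ (by positivity)] at h
    linarith
  have hfin : (8 + 2 * x) * √(10 * (A + l) / ⌈N⌉₊) ≤ ε := by
    rwa [le_div_iff₀' (by positivity)] at hbound
  refine ⟨⌈N⌉₊, Nat.ceil_pos.2 hN0, ?_, ?_, hfin⟩
  · have h1 : 8 + 2 * x ≤ (8 / k + 2) * x := by
      have : 8 ≤ 8 / k * x := by
        rw [div_mul_eq_mul_div, le_div_iff₀ hk0]; linarith
      linarith
    have h2 : A + l ≤ (A / k + 1) * l := by
      have : A ≤ A / k * l := by
        rw [div_mul_eq_mul_div, le_div_iff₀ hk0]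
        exact mul_le_mul_of_nonneg_left hkl hA
      linarith
    have h3 : 1 ≤ 1 / k ^ 3 * (x ^ 2 * l) / ε ^ 2 := by
      rw [le_div_iff₀ (by positivity), one_mul, div_mul_eq_mul_div, one_mul,
        le_div_iff₀ (by positivity)]
      calc ε ^ 2 * k ^ 3 ≤ 1 * k ^ 3 :=
            mul_le_mul_of_nonneg_right (pow_le_one₀ hε.le hε1) (by positivity)
        _ = k ^ 2 * k := by ring
        _ ≤ x ^ 2 * l := by gcongr
    have h4 : N ≤ ((8 / k + 2) * x) ^ 2 * (10 * ((A / k + 1) * l)) / ε ^ 2 := by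
      rw [hN]; gcongr
    have h5 : (⌈N⌉₊ : ℝ) ≤ N + 1 := (Nat.ceil_lt_add_one hN0.le).le
    calc (m : ℝ) * ⌈N⌉₊ ≤ m * (((8 / k + 2) * x) ^ 2 * (10 * ((A / k + 1) * l)) / ε ^ 2
          + 1 / k ^ 3 * (x ^ 2 * l) / ε ^ 2) := by gcongr; linarith
      _ = _ := by ring
  · refine le_trans (mul_le_mul_of_nonneg_right ?_ (Real.sqrt_nonneg _)) hfin
    linarith

end GDRO

end

theorem theorem1 (D G : ℝ) :
    -- the bounds in expectation and with high probability
    (∀ (m T : ℕ), 1 ≤ m → 1 ≤ T →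
      ∀ (E : Type uE) (Z : Type uZ) (Ω : Type uO)
          [NormedAddCommGroup E] [NormedSpace ℝ E] [FiniteDimensional ℝ E]
        [MeasurableSpace E] [BorelSpace E] [MeasurableSpace Z] [MeasurableSpace Ω]
        (x : GDRO.Execution E Z Ω D G m T),
        Integrable x.error x.μ ∧
        ∫ ω, x.error ω ∂x.μ ≤ 2 * √(10 * (D ^ 2 * G ^ 2 + Real.log m) / T) ∧
        ∀ δ : ℝ, 0 < δ → δ < 1 →
          ENNReal.ofReal (1 - δ) ≤ x.μ {ω | x.error ω ≤
            (8 + 2 * Real.log (2 / δ)) * √(10 * (D ^ 2 * G ^ 2 + Real.log m) / T)}) ∧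
    -- the sample complexity: `m * T` samples, of order `m * log m / ε ^ 2`, suffice for error `ε`
    (∃ C : ℝ, 0 < C ∧ ∀ (m : ℕ) (ε δ : ℝ), 2 ≤ m → 0 < ε → ε ≤ 1 → 0 < δ → δ < 1 →
      ∃ T : ℕ, 1 ≤ T ∧
        (m * T : ℝ) ≤ C * Real.log (2 / δ) ^ 2 * (m * Real.log m) / ε ^ 2 ∧
        ∀ (E : Type uE) (Z : Type uZ) (Ω : Type uO)
          [NormedAddCommGroup E] [NormedSpace ℝ E] [FiniteDimensional ℝ E]
          [MeasurableSpace E] [BorelSpace E] [MeasurableSpace Z] [MeasurableSpace Ω]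
          (x : GDRO.Execution E Z Ω D G m T),
          Integrable x.error x.μ ∧ ∫ ω, x.error ω ∂x.μ ≤ ε ∧
          ENNReal.ofReal (1 - δ) ≤ x.μ {ω | x.error ω ≤ ε}) := by
  refine ⟨fun m T hm hT E Z Ω _ _ _ _ _ _ _ x => ⟨x.integrable_error hm hT,
    x.integral_error_le hm hT, fun δ hδ _ => x.measure_error_le hm hT hδ⟩, ?_⟩
  obtain ⟨C, hC, h⟩ := GDRO.exists_rounds (D ^ 2 * G ^ 2) (by positivity)
  refine ⟨C, hC, fun m ε δ hm hε hε1 hδ hδ1 => ?_⟩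
  obtain ⟨T, hT, hmT, hexp, hprob⟩ := h m ε δ hm hε hε1 hδ hδ1
  have hm1 : 1 ≤ m := one_le_two.trans hm
  refine ⟨T, hT, hmT, fun E Z Ω _ _ _ _ _ _ _ x => ⟨x.integrable_error hm1 hT,
    (x.integral_error_le hm1 hT).trans hexp, (x.measure_error_le hm1 hT hδ).trans ?_⟩⟩
  exact MeasureTheory.measure_mono fun ω hω => le_trans hω hprob
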